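/- **Setting.** Let $\mathbb K$ be a field of characteristic zero and $n\in\mathbb Z$. All graphs are finite; multiple edges and loops are allowed. A bald graph has $N$ numbered vertices and $k$ numbered directed edges. A hairy graph is a graph with one additional external vertex, $N$ numbered internal vertices and $k$ numbered directed edges; the edges at the external vertex are the hairs. Graphs are identified up to relabelling with sign: for $n$ even, renumbering the edges (hairs included) by $\pi$ gives the factor $\operatorname{sgn}\pi$, while renumbering (internal) vertices and reversing edges gives no sign; for $n$ odd, renumbering the (internal) vertices by $\sigma$ gives $\operatorname{sgn}\sigma$, reversing an edge or hair gives $-1$, and renumbering edges gives no sign. All spaces below consist of formal series, that is, of families of finite $\mathbb K$-linear combinations indexed by $(N,k)$. * $\mathrm{GC}_n$ is spanned by the non-empty connected bald graphs with all vertices at least trivalent. $\mathrm{GC}_n^{1vi}\subset \mathrm{GC}_n$ is spanned by those which are one-vertex irreducible: they have no loop edges and stay connected and non-empty after deletion of any one vertex. The differential is $\delta\Gamma=\sum_x(\tfrac12 s_x-a_x)$, where $s_x$ is the sum over all ways of splitting the vertex $x$ into $x$ and a new vertex joined to $x$ by a new edge, and $a_x$ attaches to $x$ a new edge ending at a new univalent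 vertex. * $\mathrm{HGC}_{0,n}$ is spanned by the hairy graphs with at least one hair, no edge joining the external vertex to itself, all internal vertices at least trivalent, and a non-empty connected graph left after deletion of the external vertex. On it, $\delta$ is the sum over all splittings of internal vertices into two vertices of valence at least three, and $D\Gamma=\delta\Gamma+\sum_S\Gamma_S$, where $S$ runs over the sets of at least two hairs of $\Gamma$, and $\Gamma_S$ is obtained by connecting the hairs in $S$ to a new internal vertex that carries one new hair. * $\gamma_1$ is the sum over all vertices of $\gamma$ of the hairy graphs in which this vertex is deleted and its incident edges are declared hairs. $F(\gamma)$ is the sum over all vertices of $\gamma$ of the hairy graphs with one hair attached at this vertex. In $\delta$, $D$ and $F$ the new vertex and the new edge or hair are numbered last, the new edge is directed towards the new vertex, and the new hair is directed away from the external vertex. In $\gamma_1$ the deleted vertex is first moved to the first place. **Proposition.** The map $\delta$ preserves $\mathrm{GC}_n^{1vi}$, $D$ preserves $\mathrm{HGC}_{0,n}$, $F$ maps $\mathrm{GC}_n$ to $\mathrm{HGC}_{0,n}$, and $\gamma\mapsto\gamma_1$ maps $\mathrm{GC}_n^{1vi}$ to $\mathrm{HGC}_{0,n}$. For every $\gamma\in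 \mathrm{GC}_n^{1vi}$, $$(\delta\gamma)_1=D\gamma_1\pm F(\gamma),$$ where on the part of $\gamma$ with $N$ vertices the sign $\pm$ is $-1$ if $n$ is even and $(-1)^N$ if $n$ is odd. Consequently, if $\gamma\in \mathrm{GC}_n^{1vi}$ and $\delta\gamma=0$, then $\delta F(\gamma)=0$, and $F(\gamma)=\mp D\gamma_1$ with the opposite sign on each such part. In particular $F(\gamma)=DX$ with $X=\mp\gamma_1\in\mathrm{HGC}_{0,n}$ (the sign again taken on each part), so $F(\gamma)$ is explicitly a $D$-coboundary. -/

import Mathlib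

open scoped BigOperators

noncomputable section

namespace HairyGraph

/-! ### Labelled graphs -/

/-- Vertices of a graph with `r` numbered external vertices (`Sum.inl`) and `N` internal vertices
(`Sum.inr`). -/
abbrev Vert (r N : ℕ) : Type := Fin r ⊕ Fin N

/-- A labelled directed graph (multiple edges and loops are allowed) with `r` external vertices,
`N` internal vertices and `k` numbered edges; the edge `i` goes from `(Γ i).1` to `(Γ i).2`.

* For `r = 0` these are the ordinary (bald) labelled graphs.
* For `r = 1` these are the labelled hairy graphs: an edge between an internal vertex and the
  external vertex is a hair.  The `k` edges include the hairs. -/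
abbrev LGraph (r N k : ℕ) : Type := Fin k → Vert r N × Vert r N

variable {r N k : ℕ}

/-- The end of a half-edge: `(i, false)` is the half-edge of `i` at its source, `(i, true)` the
half-edge of `i` at its target. -/
def endpoint (Γ : LGraph r N k) (h : Fin k × Bool) : Vert r N :=
  if h.2 then (Γ h.1).2 else (Γ h.1).1

/-- The half-edges at a vertex. -/
def halfEdges (Γ : LGraph r N k) (v : Vert r N) : Finset (Fin k × Bool) :=
  Finset.univ.filter fun h => endpoint Γ h = v

/-- The valence of a vertex (hairs count, a loop counts twice). -/
def valence (Γ : LGraph r N k) (v : Vert r N) : ℕ := (halfEdges Γ v).card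

/-- Renumber the edges. -/
def permEdges (π : Equiv.Perm (Fin k)) (Γ : LGraph r N k) : LGraph r N k := fun i => Γ (π i)

/-- Reverse the direction of the edge `i`. -/
def flipEdge (i : Fin k) (Γ : LGraph r N k) : LGraph r N k := Function.update Γ i (Γ i).swap

/-- Renumber the internal vertices. -/
def permVert (σ : Equiv.Perm (Fin N)) (Γ : LGraph r N k) : LGraph r N k :=
  fun i => Prod.map (Sum.map id σ) (Sum.map id σ) (Γ i)

/-! ### The ambient graded spaces -/

section Spaces

variable (K : Type*) [Field K] (n : ℤ)

/-- Sign of a renumbering of the edges: edges have degree `1 - n`, so they are odd for `n` even. -/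
def edgeSign (π : Equiv.Perm (Fin k)) : K := if Even n then ((Equiv.Perm.sign π : ℤ) : K) else 1

/-- Sign of reversing one edge: it is `-1` for `n` odd. -/
def flipSign : K := if Even n then 1 else -1

/-- Sign of a renumbering of the internal vertices: they have degree `n`, so they are odd for `n`
odd. -/
def vertSign (σ : Equiv.Perm (Fin N)) : K := if Even n then 1 else ((Equiv.Perm.sign σ : ℤ) : K)

/-- The relations identifying a labelled graph with its relabellings, up to sign. -/
def relations (r N k : ℕ) : Submodule K (LGraph r N k →₀ K) :=
  Submodule.span K
    ({x | ∃ (π : Equiv.Perm (Fin k)) (Γ : LGraph r N k), x = Finsupp.single (permEdges π Γ) 1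
        - edgeSign K n π • Finsupp.single Γ 1} ∪
     {x | ∃ (i : Fin k) (Γ : LGraph r N k), x = Finsupp.single (flipEdge i Γ) 1
        - flipSign K n • Finsupp.single Γ 1} ∪
     {x | ∃ (σ : Equiv.Perm (Fin N)) (Γ : LGraph r N k), x = Finsupp.single (permVert σ Γ) 1
        - vertSign K n σ • Finsupp.single Γ 1})

/-- Linear combinations of graphs with `r` external vertices, `N` internal vertices and `k` edges,
modulo relabelling up to sign. -/
abbrev Comp (r N k : ℕ) : Type _ := (LGraph r N k →₀ K) ⧸ relations K n r N k

/-- The class of a labelled graph. -/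
def cls (Γ : LGraph r N k) : Comp K n r N k := (relations K n r N k).mkQ (Finsupp.single Γ 1)

/-- Formal series of graphs with `r` external vertices, given by their components with `N` internal
vertices and `k` edges.  For `r = 0` the component `(N, k)` has cohomological degree
`n * N - (n - 1) * k - n`, for `r = 1` it has degree `n * N - (n - 1) * k`. -/
abbrev Series (r : ℕ) : Type _ := ∀ N k : ℕ, Comp K n r N k

end Spaces

section Lift

variable {K : Type*} [Field K] {n : ℤ} {M : Type*} [AddCommGroup M] [Module K M]

theorem cls_permEdges (π : Equiv.Perm (Fin k)) (Γ : LGraph r N k) :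
    cls K n (permEdges π Γ) = edgeSign K n π • cls K n Γ := by
  rw [← sub_eq_zero, cls, cls, ← map_smul, ← map_sub, Submodule.mkQ_apply,
    Submodule.Quotient.mk_eq_zero]
  exact Submodule.subset_span (Or.inl (Or.inl ⟨π, Γ, rfl⟩))

theorem cls_flipEdge (i : Fin k) (Γ : LGraph r N k) :
    cls K n (flipEdge i Γ) = flipSign K n • cls K n Γ := by
  rw [← sub_eq_zero, cls, cls, ← map_smul, ← map_sub, Submodule.mkQ_apply,
    Submodule.Quotient.mk_eq_zero]
  exact Submodule.subset_span (Or.inl (Or.inr ⟨i, Γ, rfl⟩))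

theorem cls_permVert (σ : Equiv.Perm (Fin N)) (Γ : LGraph r N k) :
    cls K n (permVert σ Γ) = vertSign K n σ • cls K n Γ := by
  rw [← sub_eq_zero, cls, cls, ← map_smul, ← map_sub, Submodule.mkQ_apply,
    Submodule.Quotient.mk_eq_zero]
  exact Submodule.subset_span (Or.inr ⟨σ, Γ, rfl⟩)

/-- A function on labelled graphs is compatible with relabelling. -/
structure Compatible (K : Type*) [Field K] (n : ℤ) {M : Type*} [AddCommGroup M] [Module K M]
    (f : LGraph r N k → M) : Prop where
  edges : ∀ π Γ, f (permEdges π Γ) = edgeSign K n π • f Γ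
  flip : ∀ i Γ, f (flipEdge i Γ) = flipSign K n • f Γ
  vert : ∀ σ Γ, f (permVert σ Γ) = vertSign K n σ • f Γ

/-- The linear map defined by its values on labelled graphs. -/
def lift (f : LGraph r N k → M) (hf : Compatible K n f) : Comp K n r N k →ₗ[K] M :=
  (relations K n r N k).liftQ (Finsupp.linearCombination K f) (by
    rw [relations, Submodule.span_le]
    rintro x ((⟨π, Γ, rfl⟩ | ⟨i, Γ, rfl⟩) | ⟨σ, Γ, rfl⟩)
    · simp [hf.edges]
    · simp [hf.flip]
    · simp [hf.vert])

@[simp] theorem lift_cls (f : LGraph r N k → M) (hf : Compatible K n f) (Γ : LGraph r N k) :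
    lift f hf (cls K n Γ) = f Γ := by
  simp [lift, cls]

theorem Compatible.add {f g : LGraph r N k → M} (hf : Compatible K n f) (hg : Compatible K n g) :
    Compatible K n (fun Γ => f Γ + g Γ) :=
  ⟨fun π Γ => by rw [hf.edges, hg.edges, smul_add], fun i Γ => by rw [hf.flip, hg.flip, smul_add],
    fun σ Γ => by rw [hf.vert, hg.vert, smul_add]⟩

end Lift

/-! ### Vertex splitting -/

/-- The new internal vertex, added as the last one. -/
def newVert (r N : ℕ) : Vert r (N + 1) := Sum.inr (Fin.last N)

/-- The old vertices among the vertices after adding one internal vertex. -/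
def oldVert (v : Vert r N) : Vert r (N + 1) := Sum.map id Fin.castSucc v

/-- Split the vertex `v`: add a new internal vertex, reconnect the half-edges in `T` (which are at
`v`) to the new vertex, and add the edge from `v` to the new vertex as the last edge. -/
def split (Γ : LGraph r N k) (v : Vert r N) (T : Finset (Fin k × Bool)) :
    LGraph r (N + 1) (k + 1) :=
  Fin.snoc (α := fun _ => Vert r (N + 1) × Vert r (N + 1))
    (fun i => (if (i, false) ∈ T then newVert r N else oldVert (Γ i).1,
      if (i, true) ∈ T then newVert r N else oldVert (Γ i).2))
    (oldVert v, newVert r N)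

/-- Delete the internal vertex `y` of a bald graph and declare the incident edges hairs, that is,
declare `y` to be the external vertex. -/
def deleteVert (Γ : LGraph 0 (N + 1) k) (y : Fin (N + 1)) : LGraph 1 N k :=
  fun i =>
    let f : Vert 0 (N + 1) → Vert 1 N :=
      Sum.elim Fin.elim0 (Fin.insertNth (α := fun _ => Vert 1 N) y (Sum.inl 0) fun j => Sum.inr j)
    (f (Γ i).1, f (Γ i).2)

/-- Attach one hair at the vertex `x` of a bald graph; the hair is the last edge. -/
def attachHair (Γ : LGraph 0 N k) (x : Fin N) : LGraph 1 N (k + 1) :=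
  Fin.snoc (α := fun _ => Vert 1 N × Vert 1 N)
    (fun i => Prod.map (Sum.map Fin.elim0 id) (Sum.map Fin.elim0 id) (Γ i))
    (Sum.inl 0, Sum.inr x)

section Operators

variable (K : Type*) [Field K] (n : ℤ)

/-- The sum over all splittings of `v` such that, if `a` half-edges move to the new vertex and `b`
stay at `v`, then `p a b` holds. -/
def splitSum (p : ℕ → ℕ → Prop) [DecidableRel p] (Γ : LGraph r N k) (v : Vert r N) :
    Comp K n r (N + 1) (k + 1) :=
  ∑ T ∈ (halfEdges Γ v).powerset with p T.card (halfEdges Γ v \ T).card, cls K n (split Γ v T)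

/-- `s_x`: the sum over all splittings of the internal vertex `x`. -/
def splitAll (Γ : LGraph r N k) (x : Fin N) : Comp K n r (N + 1) (k + 1) :=
  splitSum K n (fun _ _ => True) Γ (Sum.inr x)

/-- `a_x`: attach an edge, with a new univalent vertex at its other end, to the internal vertex
`x`. -/
def addEdge (Γ : LGraph r N k) (x : Fin N) : Comp K n r (N + 1) (k + 1) :=
  cls K n (split Γ (Sum.inr x) ∅)

/-- The differential `δ Γ = ∑ₓ (½ sₓ - aₓ)` of a bald labelled graph. -/
def deltaGraph (Γ : LGraph 0 N k) : Comp K n 0 (N + 1) (k + 1) :=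
  ∑ x : Fin N, ((2 : K)⁻¹ • splitAll K n Γ x - addEdge K n Γ x)

/-- The undeformed differential of a hairy labelled graph: the sum over all splittings of internal
vertices such that both resulting vertices are at least trivalent, i.e. receive at least two
half-edges in addition to the new edge.  Exchanging the two resulting vertices gives the same
splitting, whence the factor `½`. -/
def deltaHairyGraph (Γ : LGraph 1 N k) : Comp K n 1 (N + 1) (k + 1) :=
  (2 : K)⁻¹ • ∑ x : Fin N, splitSum K n (fun a b => 2 ≤ a ∧ 2 ≤ b) Γ (Sum.inr x)

/-- The deformation term of a hairy labelled graph: the sum over all sets `S` of at least two hairs;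
the hairs in `S` are connected to a new internal vertex, which gets one new hair. -/
def joinHairsGraph (Γ : LGraph 1 N k) : Comp K n 1 (N + 1) (k + 1) :=
  splitSum K n (fun a _ => 2 ≤ a) Γ (Sum.inl 0)

/-- `Γ₁` for a bald labelled graph: the sum over all vertices of the graphs where this vertex is
deleted and its incident edges are declared hairs.  For `n` odd the vertices are odd, and the deleted
vertex is first moved to the first place. -/
def oneGraph (Γ : LGraph 0 (N + 1) k) : Comp K n 1 N k :=
  ∑ y : Fin (N + 1), (if Even n then (1 : K) else (-1) ^ (y : ℕ)) • cls K n (deleteVert Γ y)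

/-- `F Γ` for a bald labelled graph: the sum over all vertices of the graphs with one hair attached
at this vertex. -/
def hairGraph (Γ : LGraph 0 N k) : Comp K n 1 N (k + 1) :=
  ∑ x : Fin N, cls K n (attachHair Γ x)

end Operators

/-! ### Compatibility of the operations with relabelling -/

section Descent

variable {K : Type*} [Field K] {n : ℤ}

/-- Extend a permutation by fixing the last element. -/
def extendPerm {m : ℕ} (π : Equiv.Perm (Fin m)) : Equiv.Perm (Fin (m + 1)) :=
  finSuccEquivLast.symm.permCongr (Equiv.optionCongr π)

@[simp] theorem extendPerm_castSucc {m : ℕ} (π : Equiv.Perm (Fin m)) (i : Fin m) :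
    extendPerm π i.castSucc = (π i).castSucc := by
  simp [extendPerm, Equiv.permCongr_apply]

@[simp] theorem extendPerm_last {m : ℕ} (π : Equiv.Perm (Fin m)) :
    extendPerm π (Fin.last m) = Fin.last m := by
  simp [extendPerm, Equiv.permCongr_apply]

theorem sign_extendPerm {m : ℕ} (π : Equiv.Perm (Fin m)) :
    Equiv.Perm.sign (extendPerm π) = Equiv.Perm.sign π := by
  rw [extendPerm, Equiv.Perm.sign_permCongr, Equiv.optionCongr_sign]

/-- The action on half-edges of a renumbering of the edges. -/
def permHalf (π : Equiv.Perm (Fin k)) : Equiv.Perm (Fin k × Bool) :=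
  Equiv.prodCongr π.symm (Equiv.refl Bool)

/-- The action on half-edges of reversing one edge. -/
def flipHalf (i : Fin k) : Equiv.Perm (Fin k × Bool) where
  toFun h := (h.1, if h.1 = i then !h.2 else h.2)
  invFun h := (h.1, if h.1 = i then !h.2 else h.2)
  left_inv h := by rcases h with ⟨j, b⟩; by_cases hj : j = i <;> simp [hj]
  right_inv h := by rcases h with ⟨j, b⟩; by_cases hj : j = i <;> simp [hj]

theorem endpoint_permEdges (π : Equiv.Perm (Fin k)) (Γ : LGraph r N k) (h : Fin k × Bool) :
    endpoint (permEdges π Γ) (permHalf π h) = endpoint Γ h := by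
  simp [endpoint, permEdges, permHalf]

theorem endpoint_flipEdge (i : Fin k) (Γ : LGraph r N k) (h : Fin k × Bool) :
    endpoint (flipEdge i Γ) (flipHalf i h) = endpoint Γ h := by
  rcases h with ⟨j, b⟩
  by_cases hj : j = i
  · subst hj; cases b <;> simp [endpoint, flipEdge, flipHalf]
  · simp [endpoint, flipEdge, flipHalf, hj]

theorem endpoint_permVert (σ : Equiv.Perm (Fin N)) (Γ : LGraph r N k) (h : Fin k × Bool) :
    endpoint (permVert σ Γ) h = Sum.map id σ (endpoint Γ h) := by
  rcases h with ⟨j, b⟩; cases b <;> simp [endpoint, permVert]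

theorem splitSum_congr (p : ℕ → ℕ → Prop) [DecidableRel p] (Γ : LGraph r N k)
    (v : Vert r N) (Γ' : LGraph r N k) (v' : Vert r N) (c : K)
    (e : Equiv.Perm (Fin k × Bool))
    (hend : ∀ h, endpoint Γ' (e h) = v' ↔ endpoint Γ h = v)
    (hcls : ∀ T, cls K n (split Γ' v' (T.map e.toEmbedding)) = c • cls K n (split Γ v T)) :
    splitSum K n p Γ' v' = c • splitSum K n p Γ v := by
  have hH : halfEdges Γ' v' = (halfEdges Γ v).map e.toEmbedding := by
    ext h
    obtain ⟨h, rfl⟩ := e.surjective h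
    simp [halfEdges, hend]
  unfold splitSum
  rw [Finset.smul_sum, hH]
  symm
  refine Finset.sum_equiv (Equiv.finsetCongr e) ?_ ?_
  · intro T
    simp only [Finset.mem_filter, Finset.mem_powerset, Equiv.finsetCongr_apply,
      Finset.map_subset_map, Finset.card_map]
    rw [← Finset.map_sdiff, Finset.card_map]
  · intro T _
    rw [Equiv.finsetCongr_apply, hcls]

theorem split_permEdges (π : Equiv.Perm (Fin k)) (Γ : LGraph r N k) (v : Vert r N)
    (T : Finset (Fin k × Bool)) :
    split (permEdges π Γ) v (T.map (permHalf π).toEmbedding)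
      = permEdges (extendPerm π) (split Γ v T) := by
  funext i
  refine Fin.lastCases ?_ (fun i => ?_) i
  · simp [split, permEdges]
  · simp only [split, permEdges, extendPerm_castSucc, Fin.snoc_castSucc, Finset.mem_map_equiv]
    simp [permHalf]

theorem split_flipEdge (i : Fin k) (Γ : LGraph r N k) (v : Vert r N)
    (T : Finset (Fin k × Bool)) :
    split (flipEdge i Γ) v (T.map (flipHalf i).toEmbedding)
      = flipEdge i.castSucc (split Γ v T) := by
  funext j
  refine Fin.lastCases ?_ (fun j => ?_) j
  · simp [split, flipEdge, (Fin.castSucc_lt_last i).ne']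
  · by_cases hj : j = i
    · subst hj
      simp only [split, flipEdge, Fin.snoc_castSucc, Finset.mem_map_equiv]
      simp [flipHalf]
    · have hj' : j.castSucc ≠ i.castSucc := fun h => hj (Fin.castSucc_injective _ h)
      simp only [split, flipEdge, Fin.snoc_castSucc, Finset.mem_map_equiv,
        Function.update_of_ne hj', Function.update_of_ne hj]
      simp [flipHalf, hj]

theorem map_extendPerm_oldVert (σ : Equiv.Perm (Fin N)) (v : Vert r N) :
    Sum.map id (extendPerm σ) (oldVert v) = oldVert (Sum.map id σ v) := by
  rcases v with v | v <;> simp [oldVert]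

theorem split_permVert (σ : Equiv.Perm (Fin N)) (Γ : LGraph r N k) (v : Vert r N)
    (T : Finset (Fin k × Bool)) :
    split (permVert σ Γ) (Sum.map id σ v) T = permVert (extendPerm σ) (split Γ v T) := by
  funext i
  refine Fin.lastCases ?_ (fun i => ?_) i
  · simp only [split, permVert, Fin.snoc_last, Prod.map_apply, map_extendPerm_oldVert]
    simp [newVert]
  · simp only [split, permVert, Fin.snoc_castSucc, Prod.map, apply_ite (Sum.map id (extendPerm σ)),
      map_extendPerm_oldVert]
    simp [newVert]

theorem cls_split_permEdges (π : Equiv.Perm (Fin k)) (Γ : LGraph r N k) (v : Vert r N)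
    (T : Finset (Fin k × Bool)) :
    cls K n (split (permEdges π Γ) v (T.map (permHalf π).toEmbedding))
      = edgeSign K n π • cls K n (split Γ v T) := by
  rw [split_permEdges, cls_permEdges, edgeSign, edgeSign, sign_extendPerm]

theorem cls_split_flipEdge (i : Fin k) (Γ : LGraph r N k) (v : Vert r N)
    (T : Finset (Fin k × Bool)) :
    cls K n (split (flipEdge i Γ) v (T.map (flipHalf i).toEmbedding))
      = flipSign K n • cls K n (split Γ v T) := by
  rw [split_flipEdge, cls_flipEdge]

theorem cls_split_permVert (σ : Equiv.Perm (Fin N)) (Γ : LGraph r N k) (v : Vert r N)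
    (T : Finset (Fin k × Bool)) :
    cls K n (split (permVert σ Γ) (Sum.map id σ v) T)
      = vertSign K n σ • cls K n (split Γ v T) := by
  rw [split_permVert, cls_permVert, vertSign, vertSign, sign_extendPerm]

theorem splitSum_permEdges (p : ℕ → ℕ → Prop) [DecidableRel p] (π : Equiv.Perm (Fin k))
    (Γ : LGraph r N k) (v : Vert r N) :
    splitSum K n p (permEdges π Γ) v = edgeSign K n π • splitSum K n p Γ v :=
  splitSum_congr p Γ v _ v _ (permHalf π) (fun h => by rw [endpoint_permEdges])
    (cls_split_permEdges π Γ v)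

theorem splitSum_flipEdge (p : ℕ → ℕ → Prop) [DecidableRel p] (i : Fin k)
    (Γ : LGraph r N k) (v : Vert r N) :
    splitSum K n p (flipEdge i Γ) v = flipSign K n • splitSum K n p Γ v :=
  splitSum_congr p Γ v _ v _ (flipHalf i) (fun h => by rw [endpoint_flipEdge])
    (cls_split_flipEdge i Γ v)

theorem splitSum_permVert (p : ℕ → ℕ → Prop) [DecidableRel p] (σ : Equiv.Perm (Fin N))
    (Γ : LGraph r N k) (v : Vert r N) :
    splitSum K n p (permVert σ Γ) (Sum.map id σ v) = vertSign K n σ • splitSum K n p Γ v := by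
  refine splitSum_congr p Γ v _ _ _ (Equiv.refl _) (fun h => ?_) (fun T => ?_)
  · have hinj : Function.Injective (Sum.map id σ : Vert r N → Vert r N) :=
      Function.injective_id.sumMap σ.injective
    rw [Equiv.refl_apply, endpoint_permVert, hinj.eq_iff]
  · simpa using cls_split_permVert σ Γ v T

theorem compatible_splitSum_ext (p : ℕ → ℕ → Prop) [DecidableRel p] (j : Fin r) :
    Compatible K n (fun Γ : LGraph r N k => splitSum K n p Γ (Sum.inl j)) :=
  ⟨fun π Γ => splitSum_permEdges p π Γ _, fun i Γ => splitSum_flipEdge p i Γ _,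
    fun σ Γ => splitSum_permVert p σ Γ (Sum.inl j)⟩

theorem compatible_splitSum_int (p : ℕ → ℕ → Prop) [DecidableRel p] :
    Compatible K n (fun Γ : LGraph r N k => ∑ x : Fin N, splitSum K n p Γ (Sum.inr x)) := by
  refine ⟨fun π Γ => ?_, fun i Γ => ?_, fun σ Γ => ?_⟩
  · simp only [splitSum_permEdges, Finset.smul_sum]
  · simp only [splitSum_flipEdge, Finset.smul_sum]
  · rw [← Equiv.sum_comp σ, Finset.smul_sum]
    exact Finset.sum_congr rfl fun x _ => splitSum_permVert p σ Γ (Sum.inr x)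

theorem compatible_addEdge :
    Compatible K n (fun Γ : LGraph 0 N k => ∑ x : Fin N, addEdge K n Γ x) := by
  refine ⟨fun π Γ => ?_, fun i Γ => ?_, fun σ Γ => ?_⟩
  · rw [Finset.smul_sum]
    exact Finset.sum_congr rfl fun x _ => by
      simpa [addEdge] using cls_split_permEdges (K := K) (n := n) π Γ (Sum.inr x) ∅
  · rw [Finset.smul_sum]
    exact Finset.sum_congr rfl fun x _ => by
      simpa [addEdge] using cls_split_flipEdge (K := K) (n := n) i Γ (Sum.inr x) ∅
  · rw [← Equiv.sum_comp σ, Finset.smul_sum]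
    exact Finset.sum_congr rfl fun x _ => cls_split_permVert σ Γ (Sum.inr x) ∅

theorem Compatible.smul {M : Type*} [AddCommGroup M] [Module K M] {f : LGraph r N k → M}
    (hf : Compatible K n f) (c : K) : Compatible K n (fun Γ => c • f Γ) :=
  ⟨fun π Γ => by rw [hf.edges, smul_comm], fun i Γ => by rw [hf.flip, smul_comm],
    fun σ Γ => by rw [hf.vert, smul_comm]⟩

theorem compatible_delta : Compatible K n (deltaGraph K n : LGraph 0 N k → _) := by
  have h : (deltaGraph K n : LGraph 0 N k → _) = fun Γ =>
      (2 : K)⁻¹ • (∑ x : Fin N, splitSum K n (fun _ _ => True) Γ (Sum.inr x))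
        + (-1 : K) • ∑ x : Fin N, addEdge K n Γ x := by
    funext Γ
    rw [deltaGraph, Finset.sum_sub_distrib, Finset.smul_sum, neg_one_smul, sub_eq_add_neg]
    rfl
  rw [h]
  exact ((compatible_splitSum_int _).smul _).add (compatible_addEdge.smul _)

theorem compatible_deltaHairy : Compatible K n (deltaHairyGraph K n : LGraph 1 N k → _) :=
  (compatible_splitSum_int _).smul _

theorem compatible_joinHairs : Compatible K n (joinHairsGraph K n : LGraph 1 N k → _) :=
  compatible_splitSum_ext _ 0

theorem attachHair_permEdges (π : Equiv.Perm (Fin k)) (Γ : LGraph 0 N k) (x : Fin N) :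
    attachHair (permEdges π Γ) x = permEdges (extendPerm π) (attachHair Γ x) := by
  funext i
  refine Fin.lastCases ?_ (fun i => ?_) i <;> simp [attachHair, permEdges]

theorem attachHair_flipEdge (i : Fin k) (Γ : LGraph 0 N k) (x : Fin N) :
    attachHair (flipEdge i Γ) x = flipEdge i.castSucc (attachHair Γ x) := by
  funext j
  refine Fin.lastCases ?_ (fun j => ?_) j
  · simp [attachHair, flipEdge, (Fin.castSucc_lt_last i).ne']
  · by_cases hj : j = i
    · subst hj; simp [attachHair, flipEdge, Prod.map, Prod.swap]
    · have hj' : j.castSucc ≠ i.castSucc := fun h => hj (Fin.castSucc_injective _ h)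
      simp [attachHair, flipEdge, Function.update_of_ne hj', Function.update_of_ne hj]

theorem attachHair_permVert (σ : Equiv.Perm (Fin N)) (Γ : LGraph 0 N k) (x : Fin N) :
    attachHair (permVert σ Γ) (σ x) = permVert σ (attachHair Γ x) := by
  funext i
  refine Fin.lastCases ?_ (fun i => ?_) i
  · simp [attachHair, permVert]
  · rcases h : Γ i with ⟨a | a, b | b⟩
    · exact a.elim0
    · exact a.elim0
    · exact b.elim0
    · simp [attachHair, permVert, h]

theorem compatible_hair : Compatible K n (hairGraph K n : LGraph 0 N k → _) := by
  refine ⟨fun π Γ => ?_, fun i Γ => ?_, fun σ Γ => ?_⟩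
  · simp only [hairGraph, attachHair_permEdges, cls_permEdges, Finset.smul_sum, edgeSign,
      sign_extendPerm]
  · simp only [hairGraph, attachHair_flipEdge, cls_flipEdge, Finset.smul_sum]
  · unfold hairGraph
    rw [← Equiv.sum_comp σ, Finset.smul_sum]
    exact Finset.sum_congr rfl fun x _ => by rw [attachHair_permVert, cls_permVert]

theorem exists_perm_succAbove (σ : Equiv.Perm (Fin (N + 1))) (y : Fin (N + 1)) :
    ∃ τ : Equiv.Perm (Fin N), (∀ i, σ (y.succAbove i) = (σ y).succAbove (τ i)) ∧
      Equiv.Perm.sign τ = (-1) ^ (σ y : ℕ) * Equiv.Perm.sign σ * (-1) ^ (y : ℕ) := by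
  set ρ : Equiv.Perm (Fin (N + 1)) := Fin.cycleRange (σ y) * σ * (Fin.cycleRange y)⁻¹ with hρ
  have h0 : ρ 0 = 0 := by
    simp [hρ, Equiv.Perm.inv_def, Fin.cycleRange_symm_zero, Fin.cycleRange_self]
  obtain ⟨⟨q, τ⟩, hτ⟩ := Equiv.Perm.decomposeFin.symm.surjective ρ
  have hq : q = 0 := by
    have := congrArg (fun f : Equiv.Perm (Fin (N + 1)) => f 0) hτ
    simpa [h0] using this
  subst hq
  refine ⟨τ, fun i => ?_, ?_⟩
  · have h1 := congrArg (fun f : Equiv.Perm (Fin (N + 1)) => f i.succ) hτ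
    simp only [Equiv.Perm.decomposeFin_symm_apply_succ, Equiv.swap_self, Equiv.refl_apply, hρ,
      Equiv.Perm.mul_apply, Equiv.Perm.inv_def, Fin.cycleRange_symm_succ] at h1
    rw [← Fin.cycleRange_symm_succ (σ y), h1, Equiv.symm_apply_apply]
  · have h2 := congrArg Equiv.Perm.sign hτ
    simpa [hρ, Fin.sign_cycleRange] using h2

theorem deleteVert_permVert (σ : Equiv.Perm (Fin (N + 1))) (τ : Equiv.Perm (Fin N))
    (y : Fin (N + 1)) (h : ∀ i, σ (y.succAbove i) = (σ y).succAbove (τ i))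
    (Γ : LGraph 0 (N + 1) k) :
    deleteVert (permVert σ Γ) (σ y) = permVert τ (deleteVert Γ y) := by
  have key : ∀ v : Vert 0 (N + 1),
      (Sum.elim Fin.elim0 (Fin.insertNth (α := fun _ => Vert 1 N) (σ y) (Sum.inl 0)
        fun j => Sum.inr j) : Vert 0 (N + 1) → Vert 1 N) (Sum.map id σ v)
      = Sum.map id τ ((Sum.elim Fin.elim0 (Fin.insertNth (α := fun _ => Vert 1 N) y (Sum.inl 0)
        fun j => Sum.inr j) : Vert 0 (N + 1) → Vert 1 N) v) := by
    rintro (v | v)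
    · exact v.elim0
    · rcases Fin.eq_self_or_eq_succAbove y v with rfl | ⟨j, rfl⟩
      · simp
      · simp [h]
  funext i
  simp only [deleteVert, permVert, Prod.map, key]

theorem compatible_one : Compatible K n (oneGraph K n : LGraph 0 (N + 1) k → _) := by
  refine ⟨fun π Γ => ?_, fun i Γ => ?_, fun σ Γ => ?_⟩
  · have h : ∀ y, deleteVert (permEdges π Γ) y = permEdges π (deleteVert Γ y) := fun y => rfl
    simp only [oneGraph, h, cls_permEdges, Finset.smul_sum]
    exact Finset.sum_congr rfl fun y _ => smul_comm _ _ _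
  · have h : ∀ y, deleteVert (flipEdge i Γ) y = flipEdge i (deleteVert Γ y) := by
      intro y
      funext j
      by_cases hj : j = i
      · subst hj; simp [deleteVert, flipEdge]
      · simp [deleteVert, flipEdge, Function.update_of_ne hj]
    simp only [oneGraph, h, cls_flipEdge, Finset.smul_sum]
    exact Finset.sum_congr rfl fun y _ => smul_comm _ _ _
  · unfold oneGraph
    rw [← Equiv.sum_comp σ, Finset.smul_sum]
    refine Finset.sum_congr rfl fun y _ => ?_
    obtain ⟨τ, hτ, hs⟩ := exists_perm_succAbove σ y
    rw [deleteVert_permVert σ τ y hτ, cls_permVert, smul_smul, smul_smul]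
    congr 1
    unfold vertSign
    split_ifs with hn
    · simp
    · rw [hs]
      push_cast
      have h1 : ((-1 : K) ^ (σ y : ℕ)) * (-1) ^ (σ y : ℕ) = 1 := by
        rw [← mul_pow]; simp
      linear_combination ((Equiv.Perm.sign σ : ℤ) : K) * (-1) ^ (y : ℕ) * h1

end Descent

/-! ### The operations on series of graphs -/

section Maps

variable (K : Type*) [Field K] (n : ℤ)

/-- Assemble maps that add one internal vertex and one edge to a map on series. -/
def shiftUp (f : ∀ N k, Comp K n r N k →ₗ[K] Comp K n r (N + 1) (k + 1)) :
    Series K n r →ₗ[K] Series K n r :=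
  LinearMap.pi fun N => LinearMap.pi fun k =>
    match N, k with
    | N + 1, k + 1 => f N k ∘ₗ LinearMap.proj k ∘ₗ LinearMap.proj N
    | 0, _ => 0
    | _ + 1, 0 => 0

/-- The differential `δ` on bald graphs. -/
def delta : Series K n 0 →ₗ[K] Series K n 0 :=
  shiftUp K n fun _ _ => lift (deltaGraph K n) compatible_delta

/-- The undeformed differential `δ` on hairy graphs. -/
def deltaHairy : Series K n 1 →ₗ[K] Series K n 1 :=
  shiftUp K n fun _ _ => lift (deltaHairyGraph K n) compatible_deltaHairy

/-- The operation joining at least two hairs. -/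
def joinHairs : Series K n 1 →ₗ[K] Series K n 1 :=
  shiftUp K n fun _ _ => lift (joinHairsGraph K n) compatible_joinHairs

/-- The deformed differential `D` on hairy graphs. -/
def D : Series K n 1 →ₗ[K] Series K n 1 := deltaHairy K n + joinHairs K n

/-- The map `γ ↦ γ₁`. -/
def one : Series K n 0 →ₗ[K] Series K n 1 :=
  LinearMap.pi fun N => LinearMap.pi fun k =>
    lift (oneGraph K n) compatible_one ∘ₗ LinearMap.proj k ∘ₗ LinearMap.proj (N + 1)

/-- The map `F` attaching one hair in all possible ways. -/
def F : Series K n 0 →ₗ[K] Series K n 1 :=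
  LinearMap.pi fun N => LinearMap.pi fun k =>
    match k with
    | k + 1 => lift (hairGraph K n) compatible_hair ∘ₗ LinearMap.proj k ∘ₗ LinearMap.proj N
    | 0 => 0

end Maps

/-! ### The graph complexes -/

/-- The simple graph of adjacency of internal vertices: its connectivity is that of the graph after
deletion of the external vertices. -/
def internalGraph (Γ : LGraph r N k) : SimpleGraph (Fin N) :=
  SimpleGraph.fromRel fun a b => ∃ i, Γ i = (Sum.inr a, Sum.inr b)

/-- Non-empty connected bald graphs with all vertices at least trivalent. -/
def IsBald (Γ : LGraph 0 N k) : Prop :=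
  (internalGraph Γ).Connected ∧ ∀ x : Fin N, 3 ≤ valence Γ (Sum.inr x)

/-- One-vertex irreducible graphs: there is no loop edge, and deleting any vertex leaves a non-empty
connected graph. -/
def IsOneVertexIrreducible (Γ : LGraph 0 N k) : Prop :=
  (∀ i, (Γ i).1 ≠ (Γ i).2) ∧ ∀ y : Fin N, ((internalGraph Γ).induce {y}ᶜ).Connected

/-- Hairy graphs: there is at least one hair, no edge connects the external vertex to itself, the
graph is non-empty and connected after deletion of the external vertex, and all internal vertices
are at least trivalent. -/
def IsHairy (Γ : LGraph 1 N k) : Prop :=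
  (internalGraph Γ).Connected ∧ (∀ x : Fin N, 3 ≤ valence Γ (Sum.inr x)) ∧
    (∀ i, Γ i ≠ (Sum.inl 0, Sum.inl 0)) ∧ ∃ i, (Γ i).1 = Sum.inl 0 ∨ (Γ i).2 = Sum.inl 0

section Complexes

variable (K : Type*) [Field K] (n : ℤ)

/-- Series of graphs with a given property. -/
def seriesOf (P : ∀ N k : ℕ, LGraph r N k → Prop) : Submodule K (Series K n r) :=
  Submodule.pi Set.univ fun N => Submodule.pi Set.univ fun k =>
    Submodule.span K (cls K n '' {Γ | P N k Γ})

/-- The graph complex `GC_n`. -/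
def GC : Submodule K (Series K n 0) := seriesOf K n fun _ _ Γ => IsBald Γ

/-- The one-vertex irreducible part `GC_n^{1vi}` of `GC_n`. -/
def GC1vi : Submodule K (Series K n 0) :=
  seriesOf K n fun _ _ Γ => IsBald Γ ∧ IsOneVertexIrreducible Γ

/-- The hairy graph complex `HGC_{0,n}`. -/
def HGC : Submodule K (Series K n 1) := seriesOf K n fun _ _ Γ => IsHairy Γ

/-- The sign in front of `F γ` for `γ` with `N` vertices. -/
def hairSign (N : ℕ) : K := if Even n then -1 else (-1) ^ N

end Complexes

end HairyGraph

end

noncomputable section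

namespace HairyGraph

variable {r N k : ℕ}

/-! ### Labelled graphs in terms of the ends of their half-edges -/

/-! The external vertex is treated as one more vertex. Deleting `y` from a bald graph then merely
renames `y` as external, and joining hairs is a splitting of the external vertex.

On graphs with all valences at least three, `δ` is half the sum over the splittings that put at
least two half-edges on each side (`deltaGraph_eq`): the empty and the full set of moved half-edges
give `2 a_x`, cancelled by `a_x` after halving, and the bivalent vertices cancel because each edge
is subdivided from both ends with opposite signs.

Now delete a vertex of a graph obtained by splitting `x`. An old vertex `y ≠ x` gives an internal
splitting of the graph with `y` deleted, hence the undeformed differential of `γ₁`. Deleting `x` or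
the new vertex gives the same sum of splittings of the external vertex, with at least two half-edges
on each side (`sum_oneGraph_split`); the factor one half makes these count once. The joining term of
`D` asks only that at least two hairs be joined, so it has further terms, in which at most one hair
is left over (`sum_joinHairs_deleteVert`). If none is left over, the deleted vertex is restored with
one hair, which gives `F γ` up to sign. If one is left over, an edge of `γ` has been cut into two
hairs; the same cut made at its other end has the opposite sign, so these terms cancel. This gives
`lift_oneGraph_deltaGraph`.

That `F γ` is closed for the undeformed differential is proved separately: `F` commutes with the two
differentials up to a sign (`lift_deltaHairyGraph_hairGraph`), by a similar count of splittings.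

All sign cancellations between the two ends of an edge rest on `edgeSign_swap_mul_flipSign`. The
preservation of the complexes is checked on labelled graphs, the essential case being
`IsOneVertexIrreducible.split`. -/

theorem ext_endpoint {Γ Γ' : LGraph r N k} (h : ∀ i b, endpoint Γ (i, b) = endpoint Γ' (i, b)) :
    Γ = Γ' := by
  funext i
  exact Prod.ext (by simpa [endpoint] using h i false) (by simpa [endpoint] using h i true)

theorem ext_endpoint_snoc {Γ Γ' : LGraph r N (k + 1)}
    (h : ∀ i b, endpoint Γ (Fin.castSucc i, b) = endpoint Γ' (Fin.castSucc i, b))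
    (hs : endpoint Γ (Fin.last k, false) = endpoint Γ' (Fin.last k, false))
    (ht : endpoint Γ (Fin.last k, true) = endpoint Γ' (Fin.last k, true)) : Γ = Γ' := by
  refine ext_endpoint fun i b => ?_
  refine Fin.lastCases ?_ (fun i => h i b) i
  cases b
  exacts [hs, ht]

theorem mem_halfEdges {Γ : LGraph r N k} {v : Vert r N} {h : Fin k × Bool} :
    h ∈ halfEdges Γ v ↔ endpoint Γ h = v := by simp [halfEdges]

theorem endpoint_permEdges' (π : Equiv.Perm (Fin k)) (Γ : LGraph r N k) (i : Fin k) (b : Bool) :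
    endpoint (permEdges π Γ) (i, b) = endpoint Γ (π i, b) := rfl

theorem endpoint_flipEdge_self (i : Fin k) (Γ : LGraph r N k) (b : Bool) :
    endpoint (flipEdge i Γ) (i, b) = endpoint Γ (i, !b) := by
  cases b <;> simp [endpoint, flipEdge]

theorem endpoint_flipEdge_of_ne {i j : Fin k} (hj : j ≠ i) (Γ : LGraph r N k) (b : Bool) :
    endpoint (flipEdge i Γ) (j, b) = endpoint Γ (j, b) := by
  cases b <;> simp [endpoint, flipEdge, hj]

theorem endpoint_split_castSucc (Γ : LGraph r N k) (v : Vert r N) (T : Finset (Fin k × Bool))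
    (i : Fin k) (b : Bool) :
    endpoint (split Γ v T) (i.castSucc, b)
      = if (i, b) ∈ T then newVert r N else oldVert (endpoint Γ (i, b)) := by
  cases b <;> simp [endpoint, split]

theorem endpoint_split_last_false (Γ : LGraph r N k) (v : Vert r N) (T : Finset (Fin k × Bool)) :
    endpoint (split Γ v T) (Fin.last k, false) = oldVert v := by
  simp [endpoint, split]

theorem endpoint_split_last_true (Γ : LGraph r N k) (v : Vert r N) (T : Finset (Fin k × Bool)) :
    endpoint (split Γ v T) (Fin.last k, true) = newVert r N := by
  simp [endpoint, split]

/-- The effect on vertices of declaring the internal vertex `y` to be external. -/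
def deleteMap (y : Fin (N + 1)) : Vert 0 (N + 1) → Vert 1 N :=
  Sum.elim Fin.elim0 (Fin.insertNth (α := fun _ => Vert 1 N) y (Sum.inl 0) fun j => Sum.inr j)

@[simp] theorem deleteMap_self (y : Fin (N + 1)) : deleteMap y (Sum.inr y) = Sum.inl 0 := by
  simp [deleteMap]

@[simp] theorem deleteMap_succAbove (y : Fin (N + 1)) (j : Fin N) :
    deleteMap y (Sum.inr (y.succAbove j)) = Sum.inr j := by
  simp [deleteMap]

theorem deleteMap_injective (y : Fin (N + 1)) : Function.Injective (deleteMap y) := by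
  rintro (a | a) (b | b) h
  · exact a.elim0
  · exact a.elim0
  · exact b.elim0
  · obtain rfl | ⟨i, rfl⟩ := Fin.eq_self_or_eq_succAbove y a
    · obtain rfl | ⟨j, rfl⟩ := Fin.eq_self_or_eq_succAbove a b <;> simp_all
    · obtain rfl | ⟨j, rfl⟩ := Fin.eq_self_or_eq_succAbove y b <;> simp_all

theorem endpoint_deleteVert (Γ : LGraph 0 (N + 1) k) (y : Fin (N + 1)) (h : Fin k × Bool) :
    endpoint (deleteVert Γ y) h = deleteMap y (endpoint Γ h) := by
  rcases h with ⟨i, b⟩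
  cases b <;> rfl

theorem halfEdges_deleteVert (Γ : LGraph 0 (N + 1) k) (y : Fin (N + 1)) (v : Vert 0 (N + 1)) :
    halfEdges (deleteVert Γ y) (deleteMap y v) = halfEdges Γ v := by
  ext h
  rw [mem_halfEdges, mem_halfEdges, endpoint_deleteVert, (deleteMap_injective y).eq_iff]

/-- The internal vertices of a bald graph as vertices of a hairy graph. -/
def baldMap : Vert 0 N → Vert 1 N := Sum.map Fin.elim0 id

@[simp] theorem baldMap_inr (x : Fin N) : baldMap (Sum.inr x) = Sum.inr x := rfl

theorem vert_zero_cases (v : Vert 0 N) : ∃ x, v = Sum.inr x := by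
  rcases v with a | x
  · exact a.elim0
  · exact ⟨x, rfl⟩

theorem baldMap_injective : Function.Injective (baldMap : Vert 0 N → Vert 1 N) := by
  intro a b h
  obtain ⟨x, rfl⟩ := vert_zero_cases a
  obtain ⟨y, rfl⟩ := vert_zero_cases b
  simpa using h

theorem endpoint_attachHair_castSucc (Γ : LGraph 0 N k) (x : Fin N) (i : Fin k) (b : Bool) :
    endpoint (attachHair Γ x) (i.castSucc, b) = baldMap (endpoint Γ (i, b)) := by
  cases b <;> simp [endpoint, attachHair, baldMap]

theorem endpoint_attachHair_last_false (Γ : LGraph 0 N k) (x : Fin N) :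
    endpoint (attachHair Γ x) (Fin.last k, false) = Sum.inl 0 := by
  simp [endpoint, attachHair]

theorem endpoint_attachHair_last_true (Γ : LGraph 0 N k) (x : Fin N) :
    endpoint (attachHair Γ x) (Fin.last k, true) = Sum.inr x := by
  simp [endpoint, attachHair]

/-! ### Exchanging the two vertices produced by a splitting -/

/-- Moving the complementary half-edges exchanges the roles of `x` and the new vertex, after which
the new edge points the wrong way. -/
theorem split_compl (Γ : LGraph r N k) (x : Fin N) {T : Finset (Fin k × Bool)}
    (hT : T ⊆ halfEdges Γ (Sum.inr x)) :
    split Γ (Sum.inr x) (halfEdges Γ (Sum.inr x) \ T)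
      = flipEdge (Fin.last k)
          (permVert (Equiv.swap x.castSucc (Fin.last N)) (split Γ (Sum.inr x) T)) := by
  refine ext_endpoint_snoc (fun i b => ?_) ?_ ?_
  · rw [endpoint_flipEdge_of_ne (Fin.castSucc_lt_last i).ne, endpoint_permVert,
      endpoint_split_castSucc, endpoint_split_castSucc]
    by_cases h : (i, b) ∈ T
    · have h' := mem_halfEdges.1 (hT h)
      simp [h, h', oldVert, newVert]
    · by_cases h2 : endpoint Γ (i, b) = Sum.inr x
      · simp [h, h2, mem_halfEdges, oldVert, newVert]
      · simp only [Finset.mem_sdiff, mem_halfEdges, h2, h, false_and, if_false]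
        rcases hv : endpoint Γ (i, b) with a | a
        · simp [oldVert]
        · have : a ≠ x := fun e => h2 (by rw [hv, e])
          simp only [oldVert, Sum.map_inr]
          rw [Equiv.swap_apply_of_ne_of_ne]
          · exact fun e => this (Fin.castSucc_injective _ e)
          · exact (Fin.castSucc_lt_last a).ne
  · rw [endpoint_flipEdge_self, endpoint_permVert]
    simp [endpoint_split_last_false, endpoint_split_last_true, oldVert, newVert]
  · rw [endpoint_flipEdge_self, endpoint_permVert]
    simp [endpoint_split_last_false, endpoint_split_last_true, oldVert, newVert]

/-- The transposition of vertices and the reversal of the new edge each give `-1` for `n` odd and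
`1` for `n` even, so their product is always `1`. -/
theorem cls_split_compl (K : Type*) [Field K] (n : ℤ) (Γ : LGraph r N k) (x : Fin N)
    {T : Finset (Fin k × Bool)} (hT : T ⊆ halfEdges Γ (Sum.inr x)) :
    cls K n (split Γ (Sum.inr x) (halfEdges Γ (Sum.inr x) \ T))
      = cls K n (split Γ (Sum.inr x) T) := by
  rw [split_compl Γ x hT, cls_flipEdge, cls_permVert, smul_smul, flipSign, vertSign,
    Equiv.Perm.sign_swap (Fin.castSucc_lt_last x).ne]
  split_ifs <;> simp

/-! ### Sums over subsets -/

section PowersetSums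

variable {α M : Type*} [AddCommMonoid M]

theorem sum_powerset_card_eq_one (s : Finset α) (f : Finset α → M) :
    ∑ T ∈ s.powerset with T.card = 1, f T = ∑ h ∈ s, f {h} := by
  rw [← Finset.powersetCard_eq_filter, Finset.powersetCard_one, Finset.sum_map]
  rfl

theorem sum_powerset_card_eq_zero (s : Finset α) (f : Finset α → M) :
    ∑ T ∈ s.powerset with T.card = 0, f T = f ∅ := by
  rw [← Finset.powersetCard_eq_filter, Finset.powersetCard_zero, Finset.sum_singleton]

variable [DecidableEq α]

theorem sum_powerset_compl (s : Finset α) (f : Finset α → M) (p : ℕ → ℕ → Prop)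
    [DecidableRel p] :
    ∑ T ∈ s.powerset with p T.card (s \ T).card, f T
      = ∑ T ∈ s.powerset with p (s \ T).card T.card, f (s \ T) := by
  refine Finset.sum_bij' (fun T _ => s \ T) (fun T _ => s \ T) ?_ ?_ ?_ ?_ ?_
  · intro T hT
    simp only [Finset.mem_filter, Finset.mem_powerset] at hT ⊢
    rw [Finset.sdiff_sdiff_eq_self hT.1]
    exact ⟨Finset.sdiff_subset, hT.2⟩
  · intro T hT
    simp only [Finset.mem_filter, Finset.mem_powerset] at hT ⊢
    rw [Finset.sdiff_sdiff_eq_self hT.1]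
    exact ⟨Finset.sdiff_subset, hT.2⟩
  all_goals
    intro T hT
    simp only [Finset.mem_filter, Finset.mem_powerset] at hT
    rw [Finset.sdiff_sdiff_eq_self hT.1]

theorem sum_powerset_card_sdiff_eq_one (s : Finset α) (f : Finset α → M) :
    ∑ T ∈ s.powerset with (s \ T).card = 1, f T = ∑ h ∈ s, f (s \ {h}) := by
  rw [sum_powerset_compl s f (fun _ b => b = 1), sum_powerset_card_eq_one s fun T => f (s \ T)]

theorem sum_powerset_card_sdiff_eq_zero (s : Finset α) (f : Finset α → M) :
    ∑ T ∈ s.powerset with (s \ T).card = 0, f T = f s := by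
  rw [sum_powerset_compl s f (fun _ b => b = 0), sum_powerset_card_eq_zero s fun T => f (s \ T),
    Finset.sdiff_empty]

/-- Sums over subsets with conditions on the sizes of the subset and its complement may be compared
size by size. -/
theorem sum_powerset_add (s : Finset α) (f : Finset α → M) (p q t : ℕ → ℕ → Prop)
    [DecidableRel p] [DecidableRel q] [DecidableRel t]
    (h : ∀ a b, a + b = s.card → (t a b ↔ p a b ∨ q a b))
    (h' : ∀ a b, a + b = s.card → ¬ (p a b ∧ q a b)) :
    ∑ T ∈ s.powerset with t T.card (s \ T).card, f T
      = ∑ T ∈ s.powerset with p T.card (s \ T).card, f T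
        + ∑ T ∈ s.powerset with q T.card (s \ T).card, f T := by
  have hc : ∀ T ∈ s.powerset, T.card + (s \ T).card = s.card := fun T hT => by
    rw [add_comm, Finset.card_sdiff_add_card_eq_card (Finset.mem_powerset.1 hT)]
  simp only [Finset.sum_filter]
  rw [← Finset.sum_add_distrib]
  refine Finset.sum_congr rfl fun T hT => ?_
  have h1 := h _ _ (hc T hT)
  have h2 := h' _ _ (hc T hT)
  by_cases hp : p T.card (s \ T).card <;> by_cases hq : q T.card (s \ T).card <;> simp_all

/-- With at least three elements, a subset missing at most one of them automatically has size at
least two. -/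
theorem sum_powerset_two_le_left (s : Finset α) (hs : 3 ≤ s.card) (f : Finset α → M) :
    ∑ T ∈ s.powerset with 2 ≤ T.card, f T
      = ∑ T ∈ s.powerset with 2 ≤ T.card ∧ 2 ≤ (s \ T).card, f T
        + (f s + ∑ h ∈ s, f (s \ {h})) := by
  rw [← sum_powerset_card_sdiff_eq_one, ← sum_powerset_card_sdiff_eq_zero s f,
    ← sum_powerset_add s f (fun _ b => b = 0) (fun _ b => b = 1) (fun _ b => b < 2)
      (by intros; omega) (by intros; omega)]
  exact sum_powerset_add s f (fun a b => 2 ≤ a ∧ 2 ≤ b) (fun _ b => b < 2) (fun a _ => 2 ≤ a)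
    (by intros; omega) (by intros; omega)

theorem sum_powerset_eq (s : Finset α) (hs : 3 ≤ s.card) (f : Finset α → M) :
    ∑ T ∈ s.powerset, f T
      = ∑ T ∈ s.powerset with 2 ≤ T.card ∧ 2 ≤ (s \ T).card, f T
        + (f s + ∑ h ∈ s, f (s \ {h})) + (f ∅ + ∑ h ∈ s, f {h}) := by
  rw [← sum_powerset_two_le_left s hs, ← sum_powerset_card_eq_one, ← sum_powerset_card_eq_zero s f,
    ← sum_powerset_add s f (fun a _ => a = 0) (fun a _ => a = 1) (fun a _ => a < 2)
      (by intros; omega) (by intros; omega),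
    ← sum_powerset_add s f (fun a _ => 2 ≤ a) (fun a _ => a < 2) (fun _ _ => True)
      (by intros; simp only [true_iff]; omega) (by intros; omega)]
  simp

end PowersetSums

/-! ### Sums over half-edges -/

theorem sum_halfEdges {M : Type*} [AddCommMonoid M] (Γ : LGraph 0 N k)
    (g : Fin N → Fin k × Bool → M) :
    ∑ x : Fin N, ∑ h ∈ halfEdges Γ (Sum.inr x), g x h
      = ∑ i : Fin k, ∑ b : Bool, Sum.elim Fin.elim0 (fun x => g x (i, b)) (endpoint Γ (i, b)) := by
  simp only [halfEdges, Finset.sum_filter]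
  rw [Finset.sum_comm, Fintype.sum_prod_type]
  refine Finset.sum_congr rfl fun i _ => Finset.sum_congr rfl fun b _ => ?_
  obtain ⟨x, hx⟩ := vert_zero_cases (endpoint Γ (i, b))
  simp [hx]

/-- In a bald graph the double sum meets every half-edge once, so it suffices that the two halves of
each edge cancel. -/
theorem sum_halfEdges_eq_zero {M : Type*} [AddCommGroup M] (Γ : LGraph 0 N k)
    (g : Fin N → Fin k × Bool → M)
    (hg : ∀ i x y, Γ i = (Sum.inr x, Sum.inr y) → g x (i, false) + g y (i, true) = 0) :
    ∑ x : Fin N, ∑ h ∈ halfEdges Γ (Sum.inr x), g x h = 0 := by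
  rw [sum_halfEdges]
  refine Finset.sum_eq_zero fun i _ => ?_
  obtain ⟨x, hx⟩ := vert_zero_cases (Γ i).1
  obtain ⟨y, hy⟩ := vert_zero_cases (Γ i).2
  have := hg i x y (Prod.ext hx hy)
  rw [Fintype.sum_bool, add_comm]
  simpa [endpoint, hx, hy] using this

/-! ### Splitting off a bivalent vertex -/

/-- Both graphs subdivide the edge `i`; they differ in which of the two pieces keeps the number `i`
and in the direction of the piece next to `y`. -/
theorem split_singleton (Γ : LGraph r N k) {i : Fin k} {x y : Vert r N} (h : Γ i = (x, y)) :
    split Γ x {(i, false)}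
      = permEdges (Equiv.swap i.castSucc (Fin.last k))
          (flipEdge (Fin.last k) (split Γ y {(i, true)})) := by
  have hi : i.castSucc ≠ Fin.last k := (Fin.castSucc_lt_last i).ne
  refine ext_endpoint_snoc (fun j b => ?_) ?_ ?_
  · rw [endpoint_permEdges', endpoint_split_castSucc]
    by_cases hj : j = i
    · subst hj
      rw [Equiv.swap_apply_left, endpoint_flipEdge_self]
      cases b
      · simp [endpoint_split_last_true]
      · rw [Bool.not_true, endpoint_split_last_false]
        simp [endpoint, h]
    · have hj' : j.castSucc ≠ i.castSucc := fun e => hj (Fin.castSucc_injective _ e)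
      rw [Equiv.swap_apply_of_ne_of_ne hj' (Fin.castSucc_lt_last j).ne,
        endpoint_flipEdge_of_ne (Fin.castSucc_lt_last j).ne, endpoint_split_castSucc]
      simp [hj]
  · rw [endpoint_permEdges', Equiv.swap_apply_right, endpoint_flipEdge_of_ne hi,
      endpoint_split_castSucc, endpoint_split_last_false]
    simp [endpoint, h]
  · rw [endpoint_permEdges', Equiv.swap_apply_right, endpoint_flipEdge_of_ne hi,
      endpoint_split_castSucc, endpoint_split_last_true]
    simp

/-- For each parity of `n`, exactly one of the two operations, exchanging two edges and reversing
one edge, is odd. -/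
theorem edgeSign_swap_mul_flipSign (K : Type*) [Field K] (n : ℤ) {i j : Fin k} (h : i ≠ j) :
    edgeSign K n (Equiv.swap i j) * flipSign K n = -1 := by
  rw [edgeSign, flipSign, Equiv.Perm.sign_swap h]
  split_ifs <;> simp

/-- The contributions of the bivalent vertices cancel: every edge is subdivided from both of its
ends. -/
theorem sum_split_singleton {K : Type*} [Field K] {n : ℤ} {M : Type*} [AddCommGroup M] [Module K M]
    (f : LGraph 0 (N + 1) (k + 1) → M) (he : ∀ π Γ, f (permEdges π Γ) = edgeSign K n π • f Γ)
    (hf : ∀ i Γ, f (flipEdge i Γ) = flipSign K n • f Γ) (Γ : LGraph 0 N k) :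
    ∑ x : Fin N, ∑ h ∈ halfEdges Γ (Sum.inr x), f (split Γ (Sum.inr x) {h}) = 0 := by
  refine sum_halfEdges_eq_zero Γ _ fun i x y h => ?_
  rw [split_singleton Γ h, he, hf, smul_smul,
    edgeSign_swap_mul_flipSign K n (Fin.castSucc_lt_last i).ne, neg_one_smul, neg_add_cancel]

/-- On graphs with vertices of valence at least three the differential is the sum over the splittings
into two vertices of valence at least three. -/
theorem deltaGraph_eq (K : Type*) [Field K] [CharZero K] (n : ℤ) (Γ : LGraph 0 N k)
    (hΓ : ∀ x : Fin N, 3 ≤ valence Γ (Sum.inr x)) :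
    deltaGraph K n Γ
      = (2 : K)⁻¹ • ∑ x : Fin N, splitSum K n (fun a b => 2 ≤ a ∧ 2 ≤ b) Γ (Sum.inr x) := by
  have h : ∀ x : Fin N, splitAll K n Γ x
      = splitSum K n (fun a b => 2 ≤ a ∧ 2 ≤ b) Γ (Sum.inr x) + (2 : K) • addEdge K n Γ x
        + (2 : K) • ∑ h ∈ halfEdges Γ (Sum.inr x), cls K n (split Γ (Sum.inr x) {h}) := by
    intro x
    -- Moving everything or nothing leaves a univalent vertex; the two graphs have the same class,
    -- whence `2 a_x`. In the same way `h1` identifies the two kinds of splittings with a bivalent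
    -- vertex.
    have h0 : cls K n (split Γ (Sum.inr x) (halfEdges Γ (Sum.inr x)))
        = cls K n (split Γ (Sum.inr x) ∅) := by
      rw [← cls_split_compl K n Γ x (Finset.empty_subset _), Finset.sdiff_empty]
    have h1 : ∑ h ∈ halfEdges Γ (Sum.inr x),
          cls K n (split Γ (Sum.inr x) (halfEdges Γ (Sum.inr x) \ {h}))
        = ∑ h ∈ halfEdges Γ (Sum.inr x), cls K n (split Γ (Sum.inr x) {h}) :=
      Finset.sum_congr rfl fun h hh => cls_split_compl K n Γ x (Finset.singleton_subset_iff.2 hh)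
    rw [splitAll, splitSum, Finset.filter_true, sum_powerset_eq _ (hΓ x), h0, h1, splitSum, addEdge,
      two_smul, two_smul]
    abel
  have h2 : (2 : K)⁻¹ * 2 = 1 := inv_mul_cancel₀ two_ne_zero
  simp only [deltaGraph, h]
  -- The bivalent terms vanish only after summation over all vertices, since each cancels against
  -- one from the other end of the same edge.
  rw [Finset.sum_sub_distrib, ← Finset.smul_sum, Finset.sum_add_distrib, Finset.sum_add_distrib,
    ← Finset.smul_sum, ← Finset.smul_sum,
    sum_split_singleton (K := K) (n := n) (cls K n) cls_permEdges cls_flipEdge, smul_zero, add_zero,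
    smul_add, smul_smul, h2, one_smul, add_sub_cancel_right]

/-! ### Deleting a vertex of a split graph -/

theorem deleteMap_castSucc_oldVert (y : Fin (N + 1)) (v : Vert 0 (N + 1)) :
    deleteMap y.castSucc (oldVert v) = oldVert (deleteMap y v) := by
  obtain ⟨x, rfl⟩ := vert_zero_cases v
  obtain rfl | ⟨j, rfl⟩ := Fin.eq_self_or_eq_succAbove y x
  · simp [oldVert]
  · have : (y.succAbove j).castSucc = y.castSucc.succAbove j.castSucc := by
      rw [Fin.castSucc_succAbove_castSucc]
    rw [deleteMap_succAbove]
    change deleteMap y.castSucc (Sum.inr (y.succAbove j).castSucc) = _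
    rw [this, deleteMap_succAbove]
    rfl

theorem deleteMap_castSucc_newVert (y : Fin (N + 1)) :
    deleteMap y.castSucc (newVert 0 (N + 1)) = newVert 1 N := by
  have : Fin.last (N + 1) = y.castSucc.succAbove (Fin.last N) := by
    rw [Fin.succAbove_of_le_castSucc _ _ (Fin.castSucc_le_castSucc_iff.2 (Fin.le_last y)), Fin.succ_last]
  rw [newVert, this, deleteMap_succAbove, newVert]

/-- Deletion only renames vertices, hence commutes with splitting. When `v` is the deleted vertex,
the right-hand side splits the external vertex. -/
theorem deleteVert_split (Γ : LGraph 0 (N + 1) k) (v : Vert 0 (N + 1)) (T : Finset (Fin k × Bool))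
    (y : Fin (N + 1)) :
    deleteVert (split Γ v T) y.castSucc = split (deleteVert Γ y) (deleteMap y v) T := by
  refine ext_endpoint_snoc (fun i b => ?_) ?_ ?_
  · rw [endpoint_deleteVert, endpoint_split_castSucc, endpoint_split_castSucc, endpoint_deleteVert]
    split_ifs
    · exact deleteMap_castSucc_newVert y
    · exact deleteMap_castSucc_oldVert y _
  · rw [endpoint_deleteVert, endpoint_split_last_false, endpoint_split_last_false]
    exact deleteMap_castSucc_oldVert y _
  · rw [endpoint_deleteVert, endpoint_split_last_true, endpoint_split_last_true]
    exact deleteMap_castSucc_newVert y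

theorem deleteVert_flipEdge (i : Fin k) (Γ : LGraph 0 (N + 1) k) (y : Fin (N + 1)) :
    deleteVert (flipEdge i Γ) y = flipEdge i (deleteVert Γ y) := by
  refine ext_endpoint fun j b => ?_
  by_cases hj : j = i
  · subst hj
    simp only [endpoint_deleteVert, endpoint_flipEdge_self]
  · simp only [endpoint_deleteVert, endpoint_flipEdge_of_ne hj]

/-- The sign of moving a vertex to the first place. -/
def moveSign (K : Type*) [Field K] (n : ℤ) (y : Fin N) : K := if Even n then 1 else (-1) ^ (y : ℕ)

theorem oneGraph_eq (K : Type*) [Field K] (n : ℤ) (Γ : LGraph 0 (N + 1) k) :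
    oneGraph K n Γ = ∑ y, moveSign K n y • cls K n (deleteVert Γ y) := rfl

/-- After the exchange in `split_compl`, deleting `x` amounts to deleting the new vertex; `τ` is
what the transposition induces on the remaining vertices. -/
theorem exists_deleteVert_split_last (Γ : LGraph 0 N k) (x : Fin N)
    {T : Finset (Fin k × Bool)} (hT : T ⊆ halfEdges Γ (Sum.inr x)) :
    ∃ τ : Equiv.Perm (Fin N), Equiv.Perm.sign τ = (-1) ^ (x : ℕ) * -1 * (-1) ^ N ∧
      deleteVert (split Γ (Sum.inr x) (halfEdges Γ (Sum.inr x) \ T)) x.castSucc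
        = flipEdge (Fin.last k)
            (permVert τ (deleteVert (split Γ (Sum.inr x) T) (Fin.last N))) := by
  obtain ⟨τ, hτ, hs⟩ := exists_perm_succAbove (Equiv.swap x.castSucc (Fin.last N)) (Fin.last N)
  refine ⟨τ, ?_, ?_⟩
  · rw [hs, Equiv.swap_apply_right, Equiv.Perm.sign_swap (Fin.castSucc_lt_last x).ne]
    rfl
  · rw [split_compl Γ x hT, deleteVert_flipEdge, ← deleteVert_permVert _ τ _ hτ,
      Equiv.swap_apply_right]

/-- For `n` odd, the sign of `τ` accounts for the two positions, and its extra `-1` cancels the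
reversal of the new edge. -/
theorem cls_deleteVert_split_last (K : Type*) [Field K] (n : ℤ) (Γ : LGraph 0 N k) (x : Fin N)
    {T : Finset (Fin k × Bool)} (hT : T ⊆ halfEdges Γ (Sum.inr x)) :
    moveSign K n (Fin.last N) • cls K n (deleteVert (split Γ (Sum.inr x) T) (Fin.last N))
      = moveSign K n x • cls K n
          (deleteVert (split Γ (Sum.inr x) (halfEdges Γ (Sum.inr x) \ T)) x.castSucc) := by
  obtain ⟨τ, hs, h⟩ := exists_deleteVert_split_last Γ x hT
  rw [h, cls_flipEdge, cls_permVert, smul_smul, smul_smul]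
  congr 1
  rw [moveSign, moveSign, flipSign, vertSign, hs]
  split_ifs
  · simp
  · have h1 : ((-1 : K) ^ (x : ℕ)) * (-1) ^ (x : ℕ) = 1 := by
      rw [← mul_pow]; simp
    push_cast
    linear_combination (-(-1 : K) ^ N) * h1

theorem splitSum_deleteVert (K : Type*) [Field K] (n : ℤ) (p : ℕ → ℕ → Prop) [DecidableRel p]
    (Γ : LGraph 0 (N + 1) k) (y : Fin (N + 1)) (v : Vert 0 (N + 1)) :
    splitSum K n p (deleteVert Γ y) (deleteMap y v)
      = ∑ T ∈ (halfEdges Γ v).powerset with p T.card (halfEdges Γ v \ T).card,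
          cls K n (deleteVert (split Γ v T) y.castSucc) := by
  rw [splitSum, halfEdges_deleteVert]
  simp only [deleteVert_split]

/-- The last term comes from deleting the new vertex. Passing to complements turns it into a second
copy of the term `y = x`, which is why `p` has to be symmetric. -/
theorem sum_oneGraph_split (K : Type*) [Field K] (n : ℤ) (p : ℕ → ℕ → Prop) [DecidableRel p]
    (hp : ∀ a b, p a b ↔ p b a) (Γ : LGraph 0 (N + 1) k) (x : Fin (N + 1)) :
    ∑ T ∈ (halfEdges Γ (Sum.inr x)).powerset with p T.card (halfEdges Γ (Sum.inr x) \ T).card,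
        oneGraph K n (split Γ (Sum.inr x) T)
      = ∑ y, moveSign K n y • splitSum K n p (deleteVert Γ y) (deleteMap y (Sum.inr x))
        + moveSign K n x • splitSum K n p (deleteVert Γ x) (Sum.inl 0) := by
  simp only [oneGraph_eq]
  simp_rw [Fin.sum_univ_castSucc (n := N + 1)]
  rw [Finset.sum_add_distrib]
  congr 1
  · rw [Finset.sum_comm]
    refine Finset.sum_congr rfl fun y _ => ?_
    rw [splitSum_deleteVert, Finset.smul_sum]
    rfl
  · rw [← deleteMap_self x, splitSum_deleteVert]
    conv_rhs => rw [sum_powerset_compl, Finset.smul_sum]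
    refine Finset.sum_congr ?_ fun T hT => ?_
    · simp only [hp]
    · exact cls_deleteVert_split_last K n Γ x
        (Finset.mem_powerset.1 (Finset.mem_filter.1 hT).1)

/-! ### Cutting half-edges off a vertex -/

/-- Turn the half-edges in `T` (which are at `x`) into hairs and attach one new hair at `x`. -/
def detach (Γ : LGraph 0 N k) (x : Fin N) (T : Finset (Fin k × Bool)) : LGraph 1 N (k + 1) :=
  Fin.snoc (α := fun _ => Vert 1 N × Vert 1 N)
    (fun i => (if (i, false) ∈ T then Sum.inl 0 else baldMap (Γ i).1,
      if (i, true) ∈ T then Sum.inl 0 else baldMap (Γ i).2))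
    (Sum.inl 0, Sum.inr x)

theorem endpoint_detach_castSucc (Γ : LGraph 0 N k) (x : Fin N) (T : Finset (Fin k × Bool))
    (i : Fin k) (b : Bool) :
    endpoint (detach Γ x T) (i.castSucc, b)
      = if (i, b) ∈ T then Sum.inl 0 else baldMap (endpoint Γ (i, b)) := by
  cases b <;> simp [endpoint, detach]

theorem endpoint_detach_last_false (Γ : LGraph 0 N k) (x : Fin N) (T : Finset (Fin k × Bool)) :
    endpoint (detach Γ x T) (Fin.last k, false) = Sum.inl 0 := by
  simp [endpoint, detach]

theorem endpoint_detach_last_true (Γ : LGraph 0 N k) (x : Fin N) (T : Finset (Fin k × Bool)) :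
    endpoint (detach Γ x T) (Fin.last k, true) = Sum.inr x := by
  simp [endpoint, detach]

theorem detach_empty (Γ : LGraph 0 N k) (x : Fin N) : detach Γ x ∅ = attachHair Γ x := by
  refine ext_endpoint_snoc (fun i b => ?_) ?_ ?_
  · simp [endpoint_detach_castSucc, endpoint_attachHair_castSucc]
  · rw [endpoint_detach_last_false, endpoint_attachHair_last_false]
  · rw [endpoint_detach_last_true, endpoint_attachHair_last_true]

/-- Both graphs cut the edge `i` into a hair at `x` and a hair at `y`. The numbers of the two hairs
are exchanged, and the hair at `x` is reversed. -/
theorem detach_singleton (Γ : LGraph 0 N k) {i : Fin k} {x y : Fin N}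
    (h : Γ i = (Sum.inr x, Sum.inr y)) :
    detach Γ x {(i, false)}
      = permEdges (Equiv.swap i.castSucc (Fin.last k))
          (flipEdge i.castSucc (detach Γ y {(i, true)})) := by
  have hi : Fin.last k ≠ i.castSucc := (Fin.castSucc_lt_last i).ne'
  refine ext_endpoint_snoc (fun j b => ?_) ?_ ?_
  · rw [endpoint_permEdges', endpoint_detach_castSucc]
    by_cases hj : j = i
    · subst hj
      rw [Equiv.swap_apply_left, endpoint_flipEdge_of_ne hi]
      cases b
      · simp [endpoint_detach_last_false]
      · rw [endpoint_detach_last_true]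
        simp [endpoint, h]
    · have hj' : j.castSucc ≠ i.castSucc := fun e => hj (Fin.castSucc_injective _ e)
      rw [Equiv.swap_apply_of_ne_of_ne hj' (Fin.castSucc_lt_last j).ne,
        endpoint_flipEdge_of_ne hj', endpoint_detach_castSucc]
      simp [hj]
  · rw [endpoint_permEdges', Equiv.swap_apply_right, endpoint_flipEdge_self,
      endpoint_detach_castSucc, endpoint_detach_last_false]
    simp
  · rw [endpoint_permEdges', Equiv.swap_apply_right, endpoint_flipEdge_self,
      endpoint_detach_castSucc, endpoint_detach_last_true]
    simp [endpoint, h]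

theorem sum_detach_singleton (K : Type*) [Field K] (n : ℤ) (Γ : LGraph 0 N k) :
    ∑ x : Fin N, ∑ h ∈ halfEdges Γ (Sum.inr x), cls K n (detach Γ x {h}) = 0 := by
  refine sum_halfEdges_eq_zero Γ _ fun i x y h => ?_
  rw [detach_singleton Γ h, cls_permEdges, cls_flipEdge, smul_smul,
    edgeSign_swap_mul_flipSign K n (Fin.castSucc_lt_last i).ne, neg_one_smul, neg_add_cancel]

/-- One cycle brings `x` to the first place, another takes the first place to the last, and the
order of the other vertices is kept. -/
theorem exists_perm_last (x : Fin (N + 1)) :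
    ∃ σ : Equiv.Perm (Fin (N + 1)), σ x = Fin.last N ∧ (∀ j, σ (x.succAbove j) = j.castSucc) ∧
      Equiv.Perm.sign σ = (-1) ^ N * (-1) ^ (x : ℕ) := by
  refine ⟨(Fin.cycleRange (Fin.last N))⁻¹ * Fin.cycleRange x, ?_, fun j => ?_, ?_⟩
  · rw [Equiv.Perm.mul_apply, Fin.cycleRange_self, Equiv.Perm.inv_def, Fin.cycleRange_symm_zero]
  · rw [Equiv.Perm.mul_apply, Fin.cycleRange_succAbove, Equiv.Perm.inv_def,
      Fin.cycleRange_symm_succ, Fin.succAbove_last]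
  · simp [Fin.sign_cycleRange]

/-- The new vertex takes over the role of the deleted `x`: the hairs in `T` are reattached to it,
the others stay hairs, and the new edge is one more hair. -/
theorem split_deleteVert_ext (Γ : LGraph 0 (N + 1) k) (x : Fin (N + 1))
    {T : Finset (Fin k × Bool)} (hT : T ⊆ halfEdges Γ (Sum.inr x)) {σ : Equiv.Perm (Fin (N + 1))}
    (h0 : σ x = Fin.last N) (h1 : ∀ j, σ (x.succAbove j) = j.castSucc) :
    split (deleteVert Γ x) (Sum.inl 0) T
      = permVert σ (detach Γ x (halfEdges Γ (Sum.inr x) \ T)) := by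
  refine ext_endpoint_snoc (fun i b => ?_) ?_ ?_
  · rw [endpoint_split_castSucc, endpoint_permVert, endpoint_detach_castSucc, endpoint_deleteVert]
    by_cases h : (i, b) ∈ T
    · simp [h, mem_halfEdges.1 (hT h), h0, newVert]
    · obtain ⟨y, hy⟩ := vert_zero_cases (endpoint Γ (i, b))
      obtain rfl | ⟨j, rfl⟩ := Fin.eq_self_or_eq_succAbove x y
      · simp [h, mem_halfEdges, hy, oldVert]
      · simp [h, mem_halfEdges, hy, oldVert, h1]
  · rw [endpoint_split_last_false, endpoint_permVert, endpoint_detach_last_false]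
    rfl
  · rw [endpoint_split_last_true, endpoint_permVert, endpoint_detach_last_true, Sum.map_inr, h0]
    rfl

/-- This is the origin of `hairSign`: for `n` odd, moving `x` to the first place and then to the
last costs `(-1) ^ N` in total, independently of `x`. -/
theorem cls_split_deleteVert_ext (K : Type*) [Field K] (n : ℤ) (Γ : LGraph 0 (N + 1) k)
    (x : Fin (N + 1)) {T : Finset (Fin k × Bool)} (hT : T ⊆ halfEdges Γ (Sum.inr x)) :
    moveSign K n x • cls K n (split (deleteVert Γ x) (Sum.inl 0) T)
      = -hairSign K n (N + 1) • cls K n (detach Γ x (halfEdges Γ (Sum.inr x) \ T)) := by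
  obtain ⟨σ, h0, h1, hs⟩ := exists_perm_last x
  rw [split_deleteVert_ext Γ x hT h0 h1, cls_permVert, smul_smul]
  congr 1
  rw [moveSign, hairSign, vertSign, hs]
  split_ifs
  · simp
  · have h1 : ((-1 : K) ^ (x : ℕ)) * (-1) ^ (x : ℕ) = 1 := by
      rw [← mul_pow]; simp
    push_cast
    rw [pow_succ]
    linear_combination ((-1 : K) ^ N) * h1

/-! ### The compatibility relation -/

/-- The sets of joined hairs are sorted by the number of hairs left over. None left over gives the
hair term, and the terms with exactly one left over cancel by `sum_detach_singleton`. -/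
theorem sum_joinHairs_deleteVert (K : Type*) [Field K] (n : ℤ) (Γ : LGraph 0 (N + 1) k)
    (hΓ : ∀ x : Fin (N + 1), 3 ≤ valence Γ (Sum.inr x)) :
    ∑ x, moveSign K n x • joinHairsGraph K n (deleteVert Γ x)
      = ∑ x, moveSign K n x •
          splitSum K n (fun a b => 2 ≤ a ∧ 2 ≤ b) (deleteVert Γ x) (Sum.inl 0)
        - hairSign K n (N + 1) • hairGraph K n Γ := by
  have h : ∀ x, moveSign K n x • joinHairsGraph K n (deleteVert Γ x)
      = moveSign K n x •
          splitSum K n (fun a b => 2 ≤ a ∧ 2 ≤ b) (deleteVert Γ x) (Sum.inl 0)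
        + (-hairSign K n (N + 1) • cls K n (attachHair Γ x)
          + -hairSign K n (N + 1) •
            ∑ h ∈ halfEdges Γ (Sum.inr x), cls K n (detach Γ x {h})) := by
    intro x
    have hH : halfEdges (deleteVert Γ x) (Sum.inl 0) = halfEdges Γ (Sum.inr x) := by
      rw [← deleteMap_self x, halfEdges_deleteVert]
    rw [joinHairsGraph, splitSum, hH, sum_powerset_two_le_left _ (hΓ x), smul_add, smul_add,
      cls_split_deleteVert_ext K n Γ x subset_rfl, Finset.sdiff_self, detach_empty, splitSum, hH]
    congr 2
    rw [Finset.smul_sum, Finset.smul_sum]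
    refine Finset.sum_congr rfl fun h hh => ?_
    rw [cls_split_deleteVert_ext K n Γ x Finset.sdiff_subset,
      Finset.sdiff_sdiff_eq_self (Finset.singleton_subset_iff.2 hh)]
  simp only [h]
  rw [Finset.sum_add_distrib, Finset.sum_add_distrib, ← Finset.smul_sum, ← Finset.smul_sum,
    sum_detach_singleton, smul_zero, add_zero, neg_smul, ← sub_eq_add_neg]
  rfl

theorem lift_oneGraph_deltaGraph (K : Type*) [Field K] [CharZero K] (n : ℤ)
    (Γ : LGraph 0 (N + 1) k) (hΓ : ∀ x : Fin (N + 1), 3 ≤ valence Γ (Sum.inr x)) :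
    lift (oneGraph K n) compatible_one (deltaGraph K n Γ)
      = lift (deltaHairyGraph K n) compatible_deltaHairy (oneGraph K n Γ)
        + lift (joinHairsGraph K n) compatible_joinHairs (oneGraph K n Γ)
        + hairSign K n (N + 1) • hairGraph K n Γ := by
  have h2 : ∀ v : Comp K n 1 (N + 1) (k + 1), (2 : K)⁻¹ • (v + v) = v := fun v => by
    rw [← two_smul K v, smul_smul, inv_mul_cancel₀ two_ne_zero, one_smul]
  have h1 : lift (joinHairsGraph K n) compatible_joinHairs (oneGraph K n Γ)
      = ∑ x, moveSign K n x • joinHairsGraph K n (deleteVert Γ x) := by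
    rw [oneGraph_eq]
    simp only [map_sum, map_smul, lift_cls]
  rw [h1, sum_joinHairs_deleteVert K n Γ hΓ, deltaGraph_eq K n Γ hΓ, oneGraph_eq]
  simp only [map_smul, map_sum, splitSum, lift_cls]
  simp only [deltaHairyGraph]
  rw [Finset.sum_congr rfl fun x _ =>
    sum_oneGraph_split K n (fun a b => 2 ≤ a ∧ 2 ≤ b) (fun _ _ => and_comm) Γ x,
    Finset.sum_add_distrib, Finset.sum_comm]
  -- The summand `x = y` becomes a splitting of the external vertex; the remaining ones are
  -- splittings of internal vertices.
  have h3 : ∀ y : Fin (N + 1), ∑ x, moveSign K n y •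
        splitSum K n (fun a b => 2 ≤ a ∧ 2 ≤ b) (deleteVert Γ y) (deleteMap y (Sum.inr x))
      = moveSign K n y • splitSum K n (fun a b => 2 ≤ a ∧ 2 ≤ b) (deleteVert Γ y) (Sum.inl 0)
        + moveSign K n y • ∑ x : Fin N,
          splitSum K n (fun a b => 2 ≤ a ∧ 2 ≤ b) (deleteVert Γ y) (Sum.inr x) := by
    intro y
    rw [← Finset.smul_sum, Fin.sum_univ_succAbove _ y, deleteMap_self, smul_add]
    simp only [deleteMap_succAbove]
  -- The external splittings now occur twice, so `h2` absorbs the factor `½`; the internal ones keep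
  -- it, as in `deltaHairyGraph`.
  rw [Finset.sum_congr rfl fun y _ => h3 y, Finset.sum_add_distrib, add_right_comm, smul_add, h2,
    Finset.smul_sum]
  simp only [smul_comm (2 : K)⁻¹, splitSum]
  abel

/-! ### Splitting a graph with one hair attached -/

section PowersetSums

variable {α β M : Type*} [AddCommMonoid M]

theorem sum_powerset_map (s : Finset α) (c : α ↪ β) (f : Finset β → M) :
    ∑ T ∈ (s.map c).powerset, f T = ∑ T ∈ s.powerset, f (T.map c) := by
  symm
  refine Finset.sum_nbij (fun T => T.map c) ?_ ?_ ?_ fun _ _ => rfl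
  · intro T hT
    exact Finset.mem_powerset.2 (Finset.map_subset_map.2 (Finset.mem_powerset.1 hT))
  · intro T _ T' _ h
    exact Finset.map_injective c h
  · intro T hT
    obtain ⟨u, hu, rfl⟩ := Finset.subset_map_iff.1 (Finset.mem_powerset.1 hT)
    exact ⟨u, Finset.mem_powerset.2 hu, rfl⟩

variable [DecidableEq α] [DecidableEq β]

theorem sum_powerset_map_filter (s : Finset α) (c : α ↪ β) (p : ℕ → ℕ → Prop) [DecidableRel p]
    (f : Finset β → M) :
    ∑ T ∈ (s.map c).powerset with p T.card (s.map c \ T).card, f T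
      = ∑ T ∈ s.powerset with p T.card (s \ T).card, f (T.map c) := by
  rw [Finset.sum_filter, sum_powerset_map, Finset.sum_filter]
  refine Finset.sum_congr rfl fun T _ => ?_
  rw [← Finset.map_sdiff, Finset.card_map, Finset.card_map]

theorem sum_powerset_insert_map_filter (s : Finset α) (c : α ↪ β) {a : β} (ha : a ∉ s.map c)
    (p : ℕ → ℕ → Prop) [DecidableRel p] (f : Finset β → M) :
    ∑ T ∈ (insert a (s.map c)).powerset with p T.card (insert a (s.map c) \ T).card, f T
      = ∑ T ∈ s.powerset with p T.card ((s \ T).card + 1), f (T.map c)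
        + ∑ T ∈ s.powerset with p (T.card + 1) (s \ T).card, f (insert a (T.map c)) := by
  rw [Finset.sum_filter, Finset.sum_powerset_insert ha, sum_powerset_map, sum_powerset_map,
    Finset.sum_filter, Finset.sum_filter]
  congr 1 <;> refine Finset.sum_congr rfl fun T hT => ?_
  all_goals
    have ha' : a ∉ T.map c := fun h =>
      ha (Finset.map_subset_map.2 (Finset.mem_powerset.1 hT) h)
  · rw [Finset.insert_sdiff_of_notMem _ ha', ← Finset.map_sdiff, Finset.card_insert_of_notMem,
      Finset.card_map, Finset.card_map]
    exact fun h => ha (Finset.map_subset_map.2 Finset.sdiff_subset h)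
  · rw [Finset.insert_sdiff_insert, Finset.sdiff_insert_of_notMem ha, ← Finset.map_sdiff,
      Finset.card_insert_of_notMem ha', Finset.card_map, Finset.card_map]

end PowersetSums

/-- Half-edges of a graph as half-edges of a graph with one more edge. -/
def castHalf (k : ℕ) : Fin k × Bool ↪ Fin (k + 1) × Bool :=
  Fin.castSuccEmb.prodMap (Function.Embedding.refl Bool)

@[simp] theorem castHalf_apply (i : Fin k) (b : Bool) : castHalf k (i, b) = (i.castSucc, b) := rfl

@[simp] theorem castSucc_mem_map_castHalf {T : Finset (Fin k × Bool)} {i : Fin k} {b : Bool} :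
    (i.castSucc, b) ∈ T.map (castHalf k) ↔ (i, b) ∈ T :=
  Finset.mem_map' (castHalf k) (a := (i, b))

@[simp] theorem last_notMem_map_castHalf {T : Finset (Fin k × Bool)} {b : Bool} :
    (Fin.last k, b) ∉ T.map (castHalf k) := by
  intro h
  obtain ⟨⟨i, c⟩, _, h⟩ := Finset.mem_map.1 h
  exact (Fin.castSucc_lt_last i).ne (congrArg Prod.fst h)

theorem halfEdges_attachHair_self (Γ : LGraph 0 N k) (x : Fin N) :
    halfEdges (attachHair Γ x) (Sum.inr x)
      = insert (Fin.last k, true) ((halfEdges Γ (Sum.inr x)).map (castHalf k)) := by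
  ext ⟨i, b⟩
  rw [mem_halfEdges]
  refine Fin.lastCases ?_ (fun i => ?_) i
  · cases b
    · simp [endpoint_attachHair_last_false]
    · simp [endpoint_attachHair_last_true]
  · rw [endpoint_attachHair_castSucc, Finset.mem_insert, castSucc_mem_map_castHalf, mem_halfEdges,
      ← baldMap_inr, baldMap_injective.eq_iff]
    simp [(Fin.castSucc_lt_last i).ne]

theorem halfEdges_attachHair_of_ne (Γ : LGraph 0 N k) {x y : Fin N} (h : y ≠ x) :
    halfEdges (attachHair Γ y) (Sum.inr x) = (halfEdges Γ (Sum.inr x)).map (castHalf k) := by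
  ext ⟨i, b⟩
  rw [mem_halfEdges]
  refine Fin.lastCases ?_ (fun i => ?_) i
  · cases b
    · simp [endpoint_attachHair_last_false]
    · simp [endpoint_attachHair_last_true, h]
  · rw [endpoint_attachHair_castSucc, castSucc_mem_map_castHalf, mem_halfEdges,
      ← baldMap_inr, baldMap_injective.eq_iff]

theorem oldVert_baldMap (v : Vert 0 N) : oldVert (baldMap v) = baldMap (oldVert v) := by
  obtain ⟨x, rfl⟩ := vert_zero_cases v
  rfl

/-- The hair and the new edge are added in opposite orders, so the last two edge numbers are
exchanged. The hair itself is not moved, even if `y = x`. -/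
theorem split_attachHair (Γ : LGraph 0 N k) (x y : Fin N) (T : Finset (Fin k × Bool)) :
    split (attachHair Γ y) (Sum.inr x) (T.map (castHalf k))
      = permEdges (Equiv.swap (Fin.last k).castSucc (Fin.last (k + 1)))
          (attachHair (split Γ (Sum.inr x) T) y.castSucc) := by
  refine ext_endpoint_snoc (fun j b => ?_) ?_ ?_
  · rw [endpoint_permEdges', endpoint_split_castSucc]
    refine Fin.lastCases ?_ (fun j => ?_) j
    · rw [Equiv.swap_apply_left, if_neg last_notMem_map_castHalf]
      cases b
      · rw [endpoint_attachHair_last_false, endpoint_attachHair_last_false]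
        rfl
      · rw [endpoint_attachHair_last_true, endpoint_attachHair_last_true]
        rfl
    · rw [Equiv.swap_apply_of_ne_of_ne
          (fun e => (Fin.castSucc_lt_last j).ne (Fin.castSucc_injective _ e))
          (Fin.castSucc_lt_last _).ne, endpoint_attachHair_castSucc, endpoint_attachHair_castSucc,
        endpoint_split_castSucc]
      simp only [castSucc_mem_map_castHalf, oldVert_baldMap]
      split_ifs <;> rfl
  · rw [endpoint_permEdges', Equiv.swap_apply_right, endpoint_attachHair_castSucc,
      endpoint_split_last_false, endpoint_split_last_false]
    rfl
  · rw [endpoint_permEdges', Equiv.swap_apply_right, endpoint_attachHair_castSucc,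
      endpoint_split_last_true, endpoint_split_last_true]
    rfl

theorem split_attachHair_insert (Γ : LGraph 0 N k) (x : Fin N) (T : Finset (Fin k × Bool)) :
    split (attachHair Γ x) (Sum.inr x) (insert (Fin.last k, true) (T.map (castHalf k)))
      = permEdges (Equiv.swap (Fin.last k).castSucc (Fin.last (k + 1)))
          (attachHair (split Γ (Sum.inr x) T) (Fin.last N)) := by
  refine ext_endpoint_snoc (fun j b => ?_) ?_ ?_
  · rw [endpoint_permEdges', endpoint_split_castSucc]
    refine Fin.lastCases ?_ (fun j => ?_) j
    · rw [Equiv.swap_apply_left]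
      cases b
      · rw [endpoint_attachHair_last_false, endpoint_attachHair_last_false, if_neg (by simp)]
        rfl
      · rw [endpoint_attachHair_last_true, endpoint_attachHair_last_true, if_pos (by simp)]
        rfl
    · rw [Equiv.swap_apply_of_ne_of_ne
          (fun e => (Fin.castSucc_lt_last j).ne (Fin.castSucc_injective _ e))
          (Fin.castSucc_lt_last _).ne, endpoint_attachHair_castSucc, endpoint_attachHair_castSucc,
        endpoint_split_castSucc]
      simp only [Finset.mem_insert, Prod.mk.injEq, (Fin.castSucc_lt_last j).ne, false_and, false_or,
        castSucc_mem_map_castHalf, oldVert_baldMap]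
      split_ifs <;> rfl
  · rw [endpoint_permEdges', Equiv.swap_apply_right, endpoint_attachHair_castSucc,
      endpoint_split_last_false, endpoint_split_last_false]
    rfl
  · rw [endpoint_permEdges', Equiv.swap_apply_right, endpoint_attachHair_castSucc,
      endpoint_split_last_true, endpoint_split_last_true]
    rfl

theorem cls_attachHair_split_compl (K : Type*) [Field K] (n : ℤ) (Γ : LGraph 0 N k) (x : Fin N)
    {T : Finset (Fin k × Bool)} (hT : T ⊆ halfEdges Γ (Sum.inr x)) :
    cls K n (attachHair (split Γ (Sum.inr x) (halfEdges Γ (Sum.inr x) \ T)) x.castSucc)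
      = cls K n (attachHair (split Γ (Sum.inr x) T) (Fin.last N)) := by
  have h := attachHair_permVert (Equiv.swap x.castSucc (Fin.last N)) (split Γ (Sum.inr x) T)
    (Fin.last N)
  rw [Equiv.swap_apply_right] at h
  rw [split_compl Γ x hT, attachHair_flipEdge, h, cls_flipEdge, cls_permVert, smul_smul, flipSign,
    vertSign, Equiv.Perm.sign_swap (Fin.castSucc_lt_last x).ne]
  split_ifs <;> simp

/-- The hair sits on the vertex subdividing the edge, so both ends of the edge again produce the
same graph with opposite signs. -/
theorem sum_attachHair_split_singleton (K : Type*) [Field K] (n : ℤ) (Γ : LGraph 0 N k) :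
    ∑ x : Fin N, ∑ h ∈ halfEdges Γ (Sum.inr x),
      cls K n (attachHair (split Γ (Sum.inr x) {h}) (Fin.last N)) = 0 :=
  sum_split_singleton (K := K) (n := n) (fun G => cls K n (attachHair G (Fin.last N)))
    (fun π G => by rw [attachHair_permEdges, cls_permEdges, edgeSign, edgeSign, sign_extendPerm])
    (fun i G => by rw [attachHair_flipEdge, cls_flipEdge]) Γ

/-- A hair at `x` makes further splittings admissible: those with one half-edge and the hair on the
same side. Each half-edge yields two, according to whether the hair stays or moves, and these have
equal classes. -/
theorem sum_splitSum_attachHair (K : Type*) [Field K] (n : ℤ) (Γ : LGraph 0 N k) (x : Fin N)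
    (hx : 3 ≤ valence Γ (Sum.inr x)) :
    ∑ y, splitSum K n (fun a b => 2 ≤ a ∧ 2 ≤ b) (attachHair Γ y) (Sum.inr x)
      = edgeSign K n (Equiv.swap (Fin.last k).castSucc (Fin.last (k + 1))) •
        (∑ T ∈ (halfEdges Γ (Sum.inr x)).powerset with
            2 ≤ T.card ∧ 2 ≤ (halfEdges Γ (Sum.inr x) \ T).card,
            hairGraph K n (split Γ (Sum.inr x) T)
          + (2 : K) • ∑ h ∈ halfEdges Γ (Sum.inr x),
            cls K n (attachHair (split Γ (Sum.inr x) {h}) (Fin.last N))) := by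
  set H := halfEdges Γ (Sum.inr x) with hH
  set ε := edgeSign K n (Equiv.swap (Fin.last k).castSucc (Fin.last (k + 1))) with hε
  set A : Finset (Fin k × Bool) → Fin (N + 1) → Comp K n 1 (N + 1) (k + 2) := fun T y =>
    cls K n (attachHair (split Γ (Sum.inr x) T) y) with hA
  set S : Fin (N + 1) → Comp K n 1 (N + 1) (k + 2) := fun y =>
    ∑ T ∈ H.powerset with 2 ≤ T.card ∧ 2 ≤ (H \ T).card, A T y with hS
  have hHc : 3 ≤ H.card := hx
  have h1 : ∀ y, y ≠ x →
      splitSum K n (fun a b => 2 ≤ a ∧ 2 ≤ b) (attachHair Γ y) (Sum.inr x)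
        = ε • S y.castSucc := by
    intro y hy
    rw [splitSum, halfEdges_attachHair_of_ne Γ hy,
      sum_powerset_map_filter H (castHalf k) (fun a b => 2 ≤ a ∧ 2 ≤ b), hS, Finset.smul_sum]
    refine Finset.sum_congr rfl fun T _ => ?_
    rw [split_attachHair, cls_permEdges]
  have h2 : splitSum K n (fun a b => 2 ≤ a ∧ 2 ≤ b) (attachHair Γ x) (Sum.inr x)
      = ε • S x.castSucc + ε • S (Fin.last N) + ε • (2 : K) • ∑ h ∈ H, A {h} (Fin.last N) := by
    -- The hair stays at `x` and counts towards that side; in `h4` it moves to the new vertex.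
    have h3 : ∑ T ∈ H.powerset with 2 ≤ T.card ∧ 2 ≤ (H \ T).card + 1, A T x.castSucc
        = S x.castSucc + ∑ h ∈ H, A {h} (Fin.last N) := by
      rw [sum_powerset_add H (fun T => A T x.castSucc) (fun a b => 2 ≤ a ∧ 2 ≤ b) (fun _ b => b = 1)
        (fun a b => 2 ≤ a ∧ 2 ≤ b + 1) (by intros; omega) (by intros; omega),
        sum_powerset_card_sdiff_eq_one]
      congr 1
      exact Finset.sum_congr rfl fun h hh =>
        cls_attachHair_split_compl K n Γ x (Finset.singleton_subset_iff.2 hh)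
    have h4 : ∑ T ∈ H.powerset with 2 ≤ T.card + 1 ∧ 2 ≤ (H \ T).card, A T (Fin.last N)
        = S (Fin.last N) + ∑ h ∈ H, A {h} (Fin.last N) := by
      rw [sum_powerset_add H (fun T => A T (Fin.last N)) (fun a b => 2 ≤ a ∧ 2 ≤ b)
        (fun a _ => a = 1)
        (fun a b => 2 ≤ a + 1 ∧ 2 ≤ b) (by intros; omega) (by intros; omega),
        sum_powerset_card_eq_one]
    rw [splitSum, halfEdges_attachHair_self, sum_powerset_insert_map_filter H (castHalf k)
      last_notMem_map_castHalf (fun a b => 2 ≤ a ∧ 2 ≤ b)]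
    simp only [split_attachHair, split_attachHair_insert, cls_permEdges]
    rw [← Finset.smul_sum, ← Finset.smul_sum, h3, h4, two_smul, smul_add, smul_add, smul_add]
    abel
  have h5 : ∑ T ∈ H.powerset with 2 ≤ T.card ∧ 2 ≤ (H \ T).card,
      hairGraph K n (split Γ (Sum.inr x) T) = ∑ y : Fin N, S y.castSucc + S (Fin.last N) := by
    simp only [hairGraph]
    rw [Finset.sum_comm, Fin.sum_univ_castSucc]
  rw [h5, ← Finset.add_sum_erase _ _ (Finset.mem_univ x), h2,
    Finset.sum_congr rfl fun y hy => h1 y (Finset.ne_of_mem_erase hy), ← Finset.smul_sum,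
    ← Finset.add_sum_erase Finset.univ (fun y : Fin N => S y.castSucc) (Finset.mem_univ x)]
  simp only [smul_add]
  abel

/-- The sign is that of exchanging the hair with the new edge; the surplus splittings of
`sum_splitSum_attachHair` cancel in the sum over `x`. -/
theorem lift_deltaHairyGraph_hairGraph (K : Type*) [Field K] [CharZero K] (n : ℤ)
    (Γ : LGraph 0 N k) (hΓ : ∀ x : Fin N, 3 ≤ valence Γ (Sum.inr x)) :
    lift (deltaHairyGraph K n) compatible_deltaHairy (hairGraph K n Γ)
      = edgeSign K n (Equiv.swap (Fin.last k).castSucc (Fin.last (k + 1))) •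
        lift (hairGraph K n) compatible_hair (deltaGraph K n Γ) := by
  rw [deltaGraph_eq K n Γ hΓ, hairGraph]
  simp only [splitSum, map_smul, map_sum, lift_cls]
  simp only [deltaHairyGraph]
  rw [← Finset.smul_sum, Finset.sum_comm, smul_comm]
  congr 1
  rw [Finset.sum_congr rfl fun x _ => sum_splitSum_attachHair K n Γ x (hΓ x), ← Finset.smul_sum,
    Finset.sum_add_distrib, ← Finset.smul_sum, sum_attachHair_split_singleton, smul_zero, add_zero]

/-! ### Connectivity -/

theorem internalGraph_adj {Γ : LGraph r N k} {a b : Fin N} :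
    (internalGraph Γ).Adj a b ↔
      a ≠ b ∧ ∃ i c, endpoint Γ (i, c) = Sum.inr a ∧ endpoint Γ (i, !c) = Sum.inr b := by
  simp only [internalGraph, SimpleGraph.fromRel_adj, Bool.exists_bool, endpoint, Prod.ext_iff,
    exists_or]
  simp [and_comm]

theorem reachable_of_endpoint {Γ : LGraph r N k} {a b : Fin N} {i : Fin k} {c : Bool}
    (ha : endpoint Γ (i, c) = Sum.inr a) (hb : endpoint Γ (i, !c) = Sum.inr b) :
    (internalGraph Γ).Reachable a b := by
  by_cases h : a = b
  · rw [h]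
  · exact (internalGraph_adj.2 ⟨h, i, c, ha, hb⟩).reachable

theorem connected_of_castSucc {G : SimpleGraph (Fin N)} {G' : SimpleGraph (Fin (N + 1))}
    (hG : G.Connected) {x : Fin N} (hx : G'.Reachable x.castSucc (Fin.last N))
    (h : ∀ a b, G.Adj a b → G'.Reachable a.castSucc b.castSucc) : G'.Connected := by
  rw [SimpleGraph.connected_iff_exists_forall_reachable]
  refine ⟨x.castSucc, fun w => ?_⟩
  refine Fin.lastCases hx (fun w => ?_) w
  obtain ⟨p⟩ := hG.preconnected x w
  clear hx
  induction p with
  | nil => exact SimpleGraph.Reachable.refl _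
  | cons hadj _ ih => exact (h _ _ hadj).trans ih

/-- An edge end that moves only passes from `x` to the new vertex, and these two are joined by the
new edge. -/
theorem connected_split_int {Γ : LGraph r N k} (hΓ : (internalGraph Γ).Connected) (x : Fin N)
    {T : Finset (Fin k × Bool)} (hT : T ⊆ halfEdges Γ (Sum.inr x)) :
    (internalGraph (split Γ (Sum.inr x) T)).Connected := by
  have hx : (internalGraph (split Γ (Sum.inr x) T)).Reachable x.castSucc (Fin.last N) :=
    reachable_of_endpoint (endpoint_split_last_false _ _ _) (endpoint_split_last_true _ _ _)
  have hend : ∀ i c a, endpoint Γ (i, c) = Sum.inr a →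
      ∃ a', endpoint (split Γ (Sum.inr x) T) (i.castSucc, c) = Sum.inr a' ∧
        (internalGraph (split Γ (Sum.inr x) T)).Reachable a.castSucc a' := by
    intro i c a ha
    rw [endpoint_split_castSucc, ha]
    by_cases h : (i, c) ∈ T
    · have : a = x := Sum.inr_injective (ha.symm.trans (mem_halfEdges.1 (hT h)))
      subst this
      exact ⟨Fin.last N, by rw [if_pos h]; rfl, hx⟩
    · exact ⟨a.castSucc, by rw [if_neg h]; rfl, SimpleGraph.Reachable.refl _⟩
  refine connected_of_castSucc hΓ hx fun a b hab => ?_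
  obtain ⟨_, i, c, ha, hb⟩ := internalGraph_adj.1 hab
  obtain ⟨a', ha', hra⟩ := hend i c a ha
  obtain ⟨b', hb', hrb⟩ := hend i (!c) b hb
  exact hra.trans ((reachable_of_endpoint ha' hb').trans hrb.symm)

/-- The new edge ends at an external vertex and does not help here: a moved hair is what links the
new vertex to the internal ones. -/
theorem connected_split_ext {Γ : LGraph r N k} (hΓ : (internalGraph Γ).Connected) (j : Fin r)
    {T : Finset (Fin k × Bool)} (hT : T ⊆ halfEdges Γ (Sum.inl j)) {i : Fin k} {c : Bool}
    (hi : (i, c) ∈ T) {b : Fin N} (hb : endpoint Γ (i, !c) = Sum.inr b) :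
    (internalGraph (split Γ (Sum.inl j) T)).Connected := by
  have hend : ∀ i c a, endpoint Γ (i, c) = Sum.inr a →
      endpoint (split Γ (Sum.inl j) T) (i.castSucc, c) = Sum.inr a.castSucc := by
    intro i c a ha
    rw [endpoint_split_castSucc, if_neg, ha]
    · rfl
    · intro h
      simpa [ha] using mem_halfEdges.1 (hT h)
  refine connected_of_castSucc (x := b) hΓ ?_ fun a b hab => ?_
  · refine (reachable_of_endpoint (i := i.castSucc) (c := c) ?_ (hend _ _ _ hb)).symm
    rw [endpoint_split_castSucc, if_pos hi]
    rfl
  · obtain ⟨_, i, c, ha, hb⟩ := internalGraph_adj.1 hab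
    exact reachable_of_endpoint (hend i c a ha) (hend i (!c) b hb)

/-! ### Connectivity under relabelling and deletion; one-vertex irreducibility -/

theorem internalGraph_flipEdge (i : Fin k) (Γ : LGraph r N k) :
    internalGraph (flipEdge i Γ) = internalGraph Γ := by
  ext a b
  rw [internalGraph_adj, internalGraph_adj]
  refine and_congr_right fun _ => exists_congr fun j => ?_
  by_cases hj : j = i
  · subst hj
    simp only [endpoint_flipEdge_self, Bool.exists_bool, Bool.not_not, Bool.not_true, Bool.not_false]
    exact or_comm
  · simp only [endpoint_flipEdge_of_ne hj]

/-- Renumbering the internal vertices gives an isomorphic graph of internal vertices. -/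
def internalGraphPermVert (σ : Equiv.Perm (Fin N)) (Γ : LGraph r N k) :
    internalGraph Γ ≃g internalGraph (permVert σ Γ) where
  toEquiv := σ
  map_rel_iff' {a b} := by
    have h : ∀ (h : Fin k × Bool) (a : Fin N),
        endpoint (permVert σ Γ) h = Sum.inr (σ a) ↔ endpoint Γ h = Sum.inr a := by
      intro h a
      rw [endpoint_permVert]
      rcases endpoint Γ h with v | v <;> simp
    rw [internalGraph_adj, internalGraph_adj]
    simp only [h, σ.injective.ne_iff]

/-- The graph of internal vertices after the deletion of a vertex. -/
def internalGraphDeleteVert (Γ : LGraph 0 (N + 1) k) (y : Fin (N + 1)) :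
    internalGraph (deleteVert Γ y) ≃g (internalGraph Γ).induce ({y}ᶜ : Set (Fin (N + 1))) where
  toEquiv := finSuccAboveEquiv y
  map_rel_iff' {a b} := by
    have h : ∀ (h : Fin k × Bool) (a : Fin N),
        endpoint (deleteVert Γ y) h = Sum.inr a ↔ endpoint Γ h = Sum.inr (y.succAbove a) := by
      intro h a
      rw [endpoint_deleteVert, ← deleteMap_succAbove y, (deleteMap_injective y).eq_iff]
    change (internalGraph Γ).Adj (y.succAbove a) (y.succAbove b) ↔ _
    rw [internalGraph_adj, internalGraph_adj]
    simp only [h, Fin.succAbove_right_injective.ne_iff]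

theorem IsOneVertexIrreducible.connected_deleteVert {Γ : LGraph 0 (N + 1) k}
    (h : IsOneVertexIrreducible Γ) (y : Fin (N + 1)) : (internalGraph (deleteVert Γ y)).Connected :=
  (internalGraphDeleteVert Γ y).connected_iff.2 (h.2 y)

theorem IsOneVertexIrreducible.endpoint_ne {Γ : LGraph 0 N k}
    (h : IsOneVertexIrreducible Γ) (i : Fin k) (c : Bool) :
    endpoint Γ (i, !c) ≠ endpoint Γ (i, c) := by
  have := h.1 i
  cases c
  · simpa [endpoint] using this.symm
  · simpa [endpoint] using this

/-- By `deleteVert_split` this concerns a splitting of the already connected graph without `y`. For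
`y = x` the external vertex is split, and the absence of loops makes the other end of a moved
half-edge internal. -/
theorem IsOneVertexIrreducible.connected_deleteVert_split {Γ : LGraph 0 (N + 1) k}
    (h : IsOneVertexIrreducible Γ) (x y : Fin (N + 1)) {T : Finset (Fin k × Bool)}
    (hT : T ⊆ halfEdges Γ (Sum.inr x)) (hT' : T.Nonempty) :
    (internalGraph (deleteVert (split Γ (Sum.inr x) T) y.castSucc)).Connected := by
  rw [deleteVert_split]
  rw [← halfEdges_deleteVert Γ y] at hT
  obtain rfl | ⟨j, rfl⟩ := Fin.eq_self_or_eq_succAbove y x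
  · rw [deleteMap_self] at hT ⊢
    obtain ⟨⟨i, c⟩, hi⟩ := hT'
    have h1 : endpoint Γ (i, c) = Sum.inr x := by
      have := mem_halfEdges.1 (hT hi)
      rwa [endpoint_deleteVert, ← deleteMap_self x, (deleteMap_injective x).eq_iff] at this
    obtain ⟨z, hz⟩ := vert_zero_cases (endpoint Γ (i, !c))
    obtain rfl | ⟨j, rfl⟩ := Fin.eq_self_or_eq_succAbove x z
    · exact absurd (hz.trans h1.symm) (h.endpoint_ne i c)
    · exact connected_split_ext (h.connected_deleteVert x) 0 hT hi
        (by rw [endpoint_deleteVert, hz, deleteMap_succAbove])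
  · rw [deleteMap_succAbove] at hT ⊢
    exact connected_split_int (h.connected_deleteVert y) j hT

theorem IsOneVertexIrreducible.split {Γ : LGraph 0 N k} (h : IsOneVertexIrreducible Γ) (x : Fin N)
    {T : Finset (Fin k × Bool)} (hT : T ⊆ halfEdges Γ (Sum.inr x)) (h1 : T.Nonempty)
    (h2 : (halfEdges Γ (Sum.inr x) \ T).Nonempty) :
    IsOneVertexIrreducible (split Γ (Sum.inr x) T) := by
  obtain ⟨N, rfl⟩ : ∃ M, N = M + 1 := ⟨N - 1, by have := x.2; omega⟩
  refine ⟨fun i => ?_, fun y => ?_⟩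
  · change endpoint (HairyGraph.split Γ (Sum.inr x) T) (i, false)
      ≠ endpoint (HairyGraph.split Γ (Sum.inr x) T) (i, true)
    refine Fin.lastCases ?_ (fun i => ?_) i
    · rw [endpoint_split_last_false, endpoint_split_last_true]
      simp [oldVert, newVert, (Fin.castSucc_lt_last x).ne]
    · have hne := h.endpoint_ne i true
      obtain ⟨a, ha⟩ := vert_zero_cases (endpoint Γ (i, false))
      obtain ⟨b, hb⟩ := vert_zero_cases (endpoint Γ (i, true))
      rw [Bool.not_true, ha, hb] at hne
      rw [endpoint_split_castSucc, endpoint_split_castSucc, ha, hb]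
      split_ifs with hf ht ht
      -- Both ends moved: they were both at `x`, so the edge was a loop.
      · rw [mem_halfEdges.1 (hT hf)] at ha
        rw [mem_halfEdges.1 (hT ht)] at hb
        exact absurd (ha.symm.trans hb) hne
      · simp [oldVert, newVert, (Fin.castSucc_lt_last b).ne']
      · simp [oldVert, newVert, (Fin.castSucc_lt_last a).ne]
      · simpa [oldVert] using hne
  · rw [← (internalGraphDeleteVert _ y).connected_iff]
    refine Fin.lastCases ?_ (fun y => h.connected_deleteVert_split x y hT h1) y
    -- Deleting the new vertex is, up to relabelling, deleting `x` after the complementary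
    -- splitting; this uses `h2`.
    obtain ⟨τ, -, hτ⟩ := exists_deleteVert_split_last Γ x hT
    have hc := h.connected_deleteVert_split x x Finset.sdiff_subset h2
    rw [hτ, internalGraph_flipEdge] at hc
    exact (internalGraphPermVert τ _).connected_iff.2 hc

/-! ### Valences -/

theorem card_lt_valence_split_new (Γ : LGraph r N k) (v : Vert r N) (T : Finset (Fin k × Bool)) :
    T.card < valence (split Γ v T) (newVert r N) := by
  have h : insert (Fin.last k, true) (T.map (castHalf k)) ⊆ halfEdges (split Γ v T) (newVert r N) := by
    intro h hh
    rw [mem_halfEdges]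
    obtain rfl | hh := Finset.mem_insert.1 hh
    · exact endpoint_split_last_true _ _ _
    · obtain ⟨⟨i, b⟩, hi, rfl⟩ := Finset.mem_map.1 hh
      rw [castHalf_apply, endpoint_split_castSucc, if_pos hi]
  have := Finset.card_le_card h
  rwa [Finset.card_insert_of_notMem last_notMem_map_castHalf, Finset.card_map] at this

theorem card_sdiff_lt_valence_split (Γ : LGraph r N k) (v : Vert r N) (T : Finset (Fin k × Bool)) :
    (halfEdges Γ v \ T).card < valence (split Γ v T) (oldVert v) := by
  have h : insert (Fin.last k, false) ((halfEdges Γ v \ T).map (castHalf k))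
      ⊆ halfEdges (split Γ v T) (oldVert v) := by
    intro h hh
    rw [mem_halfEdges]
    obtain rfl | hh := Finset.mem_insert.1 hh
    · exact endpoint_split_last_false _ _ _
    · obtain ⟨⟨i, b⟩, hi, rfl⟩ := Finset.mem_map.1 hh
      obtain ⟨hi, hi'⟩ := Finset.mem_sdiff.1 hi
      rw [castHalf_apply, endpoint_split_castSucc, if_neg hi', mem_halfEdges.1 hi]
  have := Finset.card_le_card h
  rwa [Finset.card_insert_of_notMem last_notMem_map_castHalf, Finset.card_map] at this

theorem valence_le_valence_split (Γ : LGraph r N k) {v w : Vert r N} (hw : w ≠ v)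
    {T : Finset (Fin k × Bool)} (hT : T ⊆ halfEdges Γ v) :
    valence Γ w ≤ valence (split Γ v T) (oldVert w) := by
  rw [valence, ← Finset.card_map (castHalf k)]
  refine Finset.card_le_card fun h hh => ?_
  obtain ⟨⟨i, b⟩, hi, rfl⟩ := Finset.mem_map.1 hh
  rw [mem_halfEdges] at hi
  rw [mem_halfEdges, castHalf_apply, endpoint_split_castSucc, if_neg, hi]
  exact fun h => hw (hi.symm.trans (mem_halfEdges.1 (hT h)))

/-- The new edge supplies the third half-edge on each side. The part left behind is constrained only
at internal `v`, as external vertices have no valence condition. -/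
theorem three_le_valence_split {Γ : LGraph r N k} (hΓ : ∀ x : Fin N, 3 ≤ valence Γ (Sum.inr x))
    (v : Vert r N) {T : Finset (Fin k × Bool)} (hT : T ⊆ halfEdges Γ v) (h1 : 2 ≤ T.card)
    (h2 : v.isRight → 2 ≤ (halfEdges Γ v \ T).card) (x : Fin (N + 1)) :
    3 ≤ valence (split Γ v T) (Sum.inr x) := by
  refine Fin.lastCases ?_ (fun x => ?_) x
  · exact h1.trans_lt (card_lt_valence_split_new Γ v T)
  · by_cases hx : Sum.inr x = v
    · subst hx
      exact (h2 rfl).trans_lt (card_sdiff_lt_valence_split Γ (Sum.inr x) T)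
    · exact (hΓ x).trans (valence_le_valence_split Γ hx hT)

/-! ### The operations preserve the graph complexes -/

theorem IsBald.split {Γ : LGraph 0 N k} (h : IsBald Γ) (x : Fin N) {T : Finset (Fin k × Bool)}
    (hT : T ⊆ halfEdges Γ (Sum.inr x)) (h1 : 2 ≤ T.card)
    (h2 : 2 ≤ (halfEdges Γ (Sum.inr x) \ T).card) : IsBald (split Γ (Sum.inr x) T) :=
  ⟨connected_split_int h.1 x hT, three_le_valence_split h.2 _ hT h1 fun _ => h2⟩

theorem isHairy_iff {Γ : LGraph 1 N k} : IsHairy Γ ↔ (internalGraph Γ).Connected ∧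
    (∀ x : Fin N, 3 ≤ valence Γ (Sum.inr x)) ∧
    (∀ i, ¬ (endpoint Γ (i, false) = Sum.inl 0 ∧ endpoint Γ (i, true) = Sum.inl 0)) ∧
    ∃ h, endpoint Γ h = Sum.inl 0 := by
  simp [IsHairy, endpoint, Prod.ext_iff]

theorem not_external_split {Γ : LGraph 1 N k}
    (h : ∀ i, ¬ (endpoint Γ (i, false) = Sum.inl 0 ∧ endpoint Γ (i, true) = Sum.inl 0))
    (v : Vert 1 N) (T : Finset (Fin k × Bool)) (i : Fin (k + 1)) :
    ¬ (endpoint (split Γ v T) (i, false) = Sum.inl 0 ∧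
      endpoint (split Γ v T) (i, true) = Sum.inl 0) := by
  refine Fin.lastCases ?_ (fun i => ?_) i
  · rw [endpoint_split_last_true]
    simp [newVert]
  · have h' : ∀ b, endpoint (split Γ v T) (i.castSucc, b) = Sum.inl 0 →
        endpoint Γ (i, b) = Sum.inl 0 := by
      intro b hb
      rw [endpoint_split_castSucc] at hb
      split_ifs at hb
      · simp [newVert] at hb
      · rcases hv : endpoint Γ (i, b) with a | a
        · rw [Subsingleton.elim a 0]
        · rw [hv] at hb
          simp [oldVert] at hb
    exact fun hi => h i ⟨h' _ hi.1, h' _ hi.2⟩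

theorem IsHairy.split_int {Γ : LGraph 1 N k} (h : IsHairy Γ) (x : Fin N)
    {T : Finset (Fin k × Bool)} (hT : T ⊆ halfEdges Γ (Sum.inr x)) (h1 : 2 ≤ T.card)
    (h2 : 2 ≤ (halfEdges Γ (Sum.inr x) \ T).card) : IsHairy (split Γ (Sum.inr x) T) := by
  rw [isHairy_iff] at h ⊢
  obtain ⟨hc, hv, he, ⟨i, b⟩, hi⟩ := h
  refine ⟨connected_split_int hc x hT, three_le_valence_split hv _ hT h1 fun _ => h2,
    not_external_split he _ _, (i.castSucc, b), ?_⟩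
  rw [endpoint_split_castSucc, if_neg, hi]
  · rfl
  · intro h
    simpa [hi] using mem_halfEdges.1 (hT h)

theorem IsHairy.split_ext {Γ : LGraph 1 N k} (h : IsHairy Γ) {T : Finset (Fin k × Bool)}
    (hT : T ⊆ halfEdges Γ (Sum.inl 0)) (h1 : 2 ≤ T.card) : IsHairy (split Γ (Sum.inl 0) T) := by
  rw [isHairy_iff] at h ⊢
  obtain ⟨hc, hv, he, -⟩ := h
  obtain ⟨⟨i, b⟩, hi⟩ : T.Nonempty := Finset.card_pos.1 (by omega)
  have hib := mem_halfEdges.1 (hT hi)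
  -- No edge joins the external vertex to itself, so the other end of a joined hair is internal.
  obtain ⟨a, ha⟩ : ∃ a, endpoint Γ (i, !b) = Sum.inr a := by
    rcases hv : endpoint Γ (i, !b) with a | a
    · rw [Subsingleton.elim a 0] at hv
      cases b
      · exact absurd ⟨hib, hv⟩ (he i)
      · exact absurd ⟨hv, hib⟩ (he i)
    · exact ⟨a, rfl⟩
  exact ⟨connected_split_ext hc 0 hT hi ha, three_le_valence_split hv _ hT h1 (by simp),
    not_external_split he _ _, (Fin.last k, false), endpoint_split_last_false _ _ _⟩

/-- Irreducibility gives connectedness and, through the absence of loops, excludes edges from the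
external vertex to itself; the positive valence of `y` gives a hair. -/
theorem isHairy_deleteVert {Γ : LGraph 0 (N + 1) k} (hΓ : IsBald Γ)
    (h : IsOneVertexIrreducible Γ) (y : Fin (N + 1)) : IsHairy (deleteVert Γ y) := by
  have he : ∀ h, endpoint (deleteVert Γ y) h = Sum.inl 0 ↔ endpoint Γ h = Sum.inr y := fun h => by
    rw [endpoint_deleteVert, ← deleteMap_self y, (deleteMap_injective y).eq_iff]
  rw [isHairy_iff]
  refine ⟨h.connected_deleteVert y, fun x => ?_, fun i hi => ?_, ?_⟩
  · rw [valence, ← deleteMap_succAbove y, halfEdges_deleteVert]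
    exact hΓ.2 _
  · rw [he, he] at hi
    exact h.endpoint_ne i true (hi.1.trans hi.2.symm)
  · obtain ⟨e, he'⟩ : (halfEdges Γ (Sum.inr y)).Nonempty :=
      Finset.card_pos.1 (lt_of_lt_of_le (by norm_num) (hΓ.2 y))
    exact ⟨e, (he e).2 (mem_halfEdges.1 he')⟩

theorem internalGraph_attachHair (Γ : LGraph 0 N k) (x : Fin N) :
    internalGraph (attachHair Γ x) = internalGraph Γ := by
  have h : ∀ (i : Fin k) (b : Bool) (a : Fin N),
      endpoint (attachHair Γ x) (i.castSucc, b) = Sum.inr a ↔ endpoint Γ (i, b) = Sum.inr a := by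
    intro i b a
    rw [endpoint_attachHair_castSucc, ← baldMap_inr, baldMap_injective.eq_iff]
  ext a b
  rw [internalGraph_adj, internalGraph_adj]
  refine and_congr_right fun _ => ⟨?_, ?_⟩
  · rintro ⟨i, c, hi⟩
    revert hi
    refine Fin.lastCases (fun hi => ?_) (fun i hi => ⟨i, c, ?_⟩) i
    · cases c <;> simp [endpoint_attachHair_last_false] at hi
    · rwa [h, h] at hi
  · rintro ⟨i, c, hi⟩
    exact ⟨i.castSucc, c, by rwa [h, h]⟩

theorem IsBald.attachHair {Γ : LGraph 0 N k} (h : IsBald Γ) (x : Fin N) :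
    IsHairy (attachHair Γ x) := by
  rw [isHairy_iff]
  refine ⟨by rw [internalGraph_attachHair]; exact h.1, fun y => ?_, fun i => ?_,
    (Fin.last k, false), endpoint_attachHair_last_false _ _⟩
  · refine (h.2 y).trans ?_
    by_cases hy : x = y
    · subst hy
      rw [valence, valence, halfEdges_attachHair_self, ← Finset.card_map (castHalf k)]
      exact Finset.card_le_card (Finset.subset_insert _ _)
    · rw [valence, valence, halfEdges_attachHair_of_ne Γ hy, Finset.card_map]
  · refine Fin.lastCases ?_ (fun i => ?_) i
    · rw [endpoint_attachHair_last_true]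
      simp
    · obtain ⟨a, ha⟩ := vert_zero_cases (endpoint Γ (i, false))
      rw [endpoint_attachHair_castSucc, ha]
      simp

/-! ### Membership of the images in the spans of admissible graphs -/

section Membership

variable {K : Type*} [Field K] {n : ℤ}

theorem splitSum_mem {p : ℕ → ℕ → Prop} [DecidableRel p] {Γ : LGraph r N k} {v : Vert r N}
    {P : LGraph r (N + 1) (k + 1) → Prop}
    (h : ∀ T ⊆ halfEdges Γ v, p T.card (halfEdges Γ v \ T).card → P (split Γ v T)) :
    splitSum K n p Γ v ∈ Submodule.span K (cls K n '' {Γ | P Γ}) := by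
  refine Submodule.sum_mem _ fun T hT => ?_
  rw [Finset.mem_filter, Finset.mem_powerset] at hT
  exact Submodule.subset_span ⟨_, h T hT.1 hT.2, rfl⟩

theorem deltaGraph_mem [CharZero K] {Γ : LGraph 0 N k} (h : IsBald Γ)
    (h' : IsOneVertexIrreducible Γ) : deltaGraph K n Γ ∈
      Submodule.span K (cls K n '' {Γ | IsBald Γ ∧ IsOneVertexIrreducible Γ}) := by
  rw [deltaGraph_eq K n Γ h.2]
  refine Submodule.smul_mem _ _ (Submodule.sum_mem _ fun x _ => splitSum_mem fun T hT hc => ?_)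
  exact ⟨h.split x hT hc.1 hc.2, h'.split x hT (Finset.card_pos.1 (by omega))
    (Finset.card_pos.1 (by omega))⟩

theorem deltaHairyGraph_mem {Γ : LGraph 1 N k} (h : IsHairy Γ) :
    deltaHairyGraph K n Γ ∈ Submodule.span K (cls K n '' {Γ | IsHairy Γ}) :=
  Submodule.smul_mem _ _ (Submodule.sum_mem _ fun x _ =>
    splitSum_mem fun _ hT hc => h.split_int x hT hc.1 hc.2)

theorem joinHairsGraph_mem {Γ : LGraph 1 N k} (h : IsHairy Γ) :
    joinHairsGraph K n Γ ∈ Submodule.span K (cls K n '' {Γ | IsHairy Γ}) :=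
  splitSum_mem fun _ hT hc => h.split_ext hT hc

theorem oneGraph_mem {Γ : LGraph 0 (N + 1) k} (h : IsBald Γ) (h' : IsOneVertexIrreducible Γ) :
    oneGraph K n Γ ∈ Submodule.span K (cls K n '' {Γ | IsHairy Γ}) :=
  Submodule.sum_mem _ fun y _ => Submodule.smul_mem _ _
    (Submodule.subset_span ⟨_, isHairy_deleteVert h h' y, rfl⟩)

theorem hairGraph_mem {Γ : LGraph 0 N k} (h : IsBald Γ) :
    hairGraph K n Γ ∈ Submodule.span K (cls K n '' {Γ | IsHairy Γ}) :=
  Submodule.sum_mem _ fun x _ => Submodule.subset_span ⟨_, h.attachHair x, rfl⟩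

theorem lift_mem {M : Type*} [AddCommGroup M] [Module K M] {f : LGraph r N k → M}
    (hf : Compatible K n f) {P : LGraph r N k → Prop} {S : Submodule K M}
    (h : ∀ Γ, P Γ → f Γ ∈ S) {x : Comp K n r N k}
    (hx : x ∈ Submodule.span K (cls K n '' {Γ | P Γ})) : lift f hf x ∈ S := by
  have : Submodule.span K (cls K n '' {Γ | P Γ}) ≤ S.comap (lift f hf) := by
    rw [Submodule.span_le]
    rintro _ ⟨Γ, hΓ, rfl⟩
    rw [SetLike.mem_coe, Submodule.mem_comap, lift_cls]
    exact h Γ hΓ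
  exact this hx

theorem mem_seriesOf {P : ∀ N k : ℕ, LGraph r N k → Prop} {γ : Series K n r} :
    γ ∈ seriesOf K n P ↔ ∀ N k, γ N k ∈ Submodule.span K (cls K n '' {Γ | P N k Γ}) := by
  simp [seriesOf, Submodule.mem_pi]

theorem shiftUp_mem {f : ∀ N k, Comp K n r N k →ₗ[K] Comp K n r (N + 1) (k + 1)}
    {P : ∀ N k : ℕ, LGraph r N k → Prop}
    (h : ∀ N k x, x ∈ Submodule.span K (cls K n '' {Γ | P N k Γ}) →
      f N k x ∈ Submodule.span K (cls K n '' {Γ | P (N + 1) (k + 1) Γ}))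
    {γ : Series K n r} (hγ : γ ∈ seriesOf K n P) : shiftUp K n f γ ∈ seriesOf K n P := by
  rw [mem_seriesOf] at hγ ⊢
  intro N k
  rcases N with _ | N
  · exact Submodule.zero_mem _
  · rcases k with _ | k
    · exact Submodule.zero_mem _
    · exact h N k _ (hγ N k)

theorem delta_mem [CharZero K] {γ : Series K n 0} (hγ : γ ∈ GC1vi K n) :
    delta K n γ ∈ GC1vi K n :=
  shiftUp_mem (P := fun _ _ Γ => IsBald Γ ∧ IsOneVertexIrreducible Γ)
    (fun _ _ _ hx => lift_mem compatible_delta (fun _ hΓ => deltaGraph_mem hΓ.1 hΓ.2) hx) hγ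

theorem one_mem {γ : Series K n 0} (hγ : γ ∈ GC1vi K n) : one K n γ ∈ HGC K n := by
  rw [GC1vi, mem_seriesOf] at hγ
  exact mem_seriesOf.2 fun N k =>
    lift_mem compatible_one (fun _ hΓ => oneGraph_mem hΓ.1 hΓ.2) (hγ (N + 1) k)

theorem F_mem {γ : Series K n 0} (hγ : γ ∈ GC K n) : F K n γ ∈ HGC K n := by
  rw [GC, mem_seriesOf] at hγ
  refine mem_seriesOf.2 fun N k => ?_
  rcases k with _ | k
  · exact Submodule.zero_mem _
  · exact lift_mem compatible_hair (fun _ hΓ => hairGraph_mem hΓ) (hγ N k)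

theorem D_mem {Γ : Series K n 1} (hΓ : Γ ∈ HGC K n) : D K n Γ ∈ HGC K n :=
  Submodule.add_mem _
    (shiftUp_mem (P := fun _ _ Γ => IsHairy Γ)
      (fun _ _ _ hx => lift_mem compatible_deltaHairy (fun _ h => deltaHairyGraph_mem h) hx) hΓ)
    (shiftUp_mem (P := fun _ _ Γ => IsHairy Γ)
      (fun _ _ _ hx => lift_mem compatible_joinHairs (fun _ h => joinHairsGraph_mem h) hx) hΓ)

end Membership

/-! ### The operations on series -/

section Series

variable {K : Type*} [Field K] {n : ℤ}

theorem span_isBald_zero {P : LGraph 0 0 k → Prop} {x : Comp K n 0 0 k}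
    (hx : x ∈ Submodule.span K (cls K n '' {Γ | IsBald Γ ∧ P Γ})) : x = 0 := by
  have h : {Γ : LGraph 0 0 k | IsBald Γ ∧ P Γ} = ∅ :=
    Set.eq_empty_of_forall_notMem fun Γ hΓ => hΓ.1.1.nonempty.elim fun a => a.elim0
  rw [h, Set.image_empty, Submodule.span_empty] at hx
  exact (Submodule.mem_bot K).1 hx

theorem one_delta_apply [CharZero K] {γ : Series K n 0} (hγ : γ ∈ GC1vi K n) (N k : ℕ) :
    one K n (delta K n γ) N k = D K n (one K n γ) N k + hairSign K n N • F K n γ N k := by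
  rw [GC1vi, mem_seriesOf] at hγ
  rcases k with _ | k
  · have h1 : one K n (delta K n γ) N 0 = 0 := map_zero (lift (oneGraph K n) compatible_one)
    have h2 : D K n (one K n γ) N 0 = 0 := by
      rcases N with _ | N <;> exact add_zero (0 : Comp K n 1 _ 0)
    have h3 : F K n γ N 0 = 0 := rfl
    rw [h1, h2, h3, smul_zero, add_zero]
  · rcases N with _ | N
    -- Without vertices there is nothing to delete and `D` has no source component, so the relation
    -- holds only because connected graphs are non-empty.
    · have h0 : γ 0 k = 0 := span_isBald_zero (hγ 0 k)
      have h1 : one K n (delta K n γ) 0 (k + 1)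
          = lift (oneGraph K n) compatible_one (lift (deltaGraph K n) compatible_delta (γ 0 k)) := rfl
      have h2 : D K n (one K n γ) 0 (k + 1) = 0 := add_zero (0 : Comp K n 1 0 (k + 1))
      have h3 : F K n γ 0 (k + 1) = lift (hairGraph K n) compatible_hair (γ 0 k) := rfl
      rw [h1, h2, h3, h0, map_zero, map_zero, map_zero, smul_zero, add_zero]
    · have h : Set.EqOn
          (lift (oneGraph K n) compatible_one ∘ₗ
            lift (deltaGraph K n) compatible_delta : Comp K n 0 (N + 1) k →ₗ[K] _)
          ((lift (deltaHairyGraph K n) compatible_deltaHairy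
              + lift (joinHairsGraph K n) compatible_joinHairs) ∘ₗ
              lift (oneGraph K n) compatible_one
            + hairSign K n (N + 1) • lift (hairGraph K n) compatible_hair :
              Comp K n 0 (N + 1) k →ₗ[K] _)
          (cls K n '' {Γ | IsBald Γ ∧ IsOneVertexIrreducible Γ}) := by
        rintro _ ⟨Γ, hΓ, rfl⟩
        simp only [LinearMap.comp_apply, LinearMap.add_apply, LinearMap.smul_apply, lift_cls]
        exact lift_oneGraph_deltaGraph K n Γ hΓ.1.2
      exact LinearMap.eqOn_span h (hγ (N + 1) k)

theorem deltaHairy_F_eq_zero [CharZero K] {γ : Series K n 0} (hγ : γ ∈ GC K n)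
    (h0 : delta K n γ = 0) : deltaHairy K n (F K n γ) = 0 := by
  rw [GC, mem_seriesOf] at hγ
  funext N k
  rcases N with _ | N
  · rfl
  rcases k with _ | _ | k
  · rfl
  -- With one edge in the target, the source is the edgeless component of `F γ`, which is zero
  -- because `F` adds an edge.
  · exact map_zero (lift (deltaHairyGraph K n) compatible_deltaHairy)
  · have h : Set.EqOn
        (lift (deltaHairyGraph K n) compatible_deltaHairy ∘ₗ
          lift (hairGraph K n) compatible_hair : Comp K n 0 N k →ₗ[K] _)
        (edgeSign K n (Equiv.swap (Fin.last k).castSucc (Fin.last (k + 1))) •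
          (lift (hairGraph K n) compatible_hair ∘ₗ
            lift (deltaGraph K n) compatible_delta) : Comp K n 0 N k →ₗ[K] _)
        (cls K n '' {Γ | IsBald Γ}) := by
      rintro _ ⟨Γ, hΓ, rfl⟩
      simp only [LinearMap.comp_apply, LinearMap.smul_apply, lift_cls]
      exact lift_deltaHairyGraph_hairGraph K n Γ hΓ.2
    have h1 : lift (deltaGraph K n) compatible_delta (γ N k) = 0 :=
      congrFun (congrFun h0 (N + 1)) (k + 1)
    refine (LinearMap.eqOn_span h (hγ N k)).trans ?_
    rw [LinearMap.smul_apply, LinearMap.comp_apply, h1, map_zero, smul_zero]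
    rfl

theorem hairSign_mul_self (N : ℕ) : hairSign K n N * hairSign K n N = 1 := by
  rw [hairSign]
  split_ifs
  · simp
  · rw [← mul_pow]; simp

theorem GC1vi_le_GC : GC1vi K n ≤ GC K n := by
  intro γ hγ
  rw [GC1vi, mem_seriesOf] at hγ
  exact mem_seriesOf.2 fun N k =>
    Submodule.span_mono (Set.image_mono fun _ h => h.1) (hγ N k)

theorem F_apply_of_delta_eq_zero [CharZero K] {γ : Series K n 0} (hγ : γ ∈ GC1vi K n)
    (h0 : delta K n γ = 0) (N k : ℕ) :
    F K n γ N k = -hairSign K n N • D K n (one K n γ) N k := by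
  have h := one_delta_apply hγ N k
  rw [h0, map_zero] at h
  have h1 : D K n (one K n γ) N k = -(hairSign K n N • F K n γ N k) :=
    eq_neg_of_add_eq_zero_left h.symm
  rw [h1, smul_neg, neg_smul, neg_neg, smul_smul, hairSign_mul_self, one_smul]

/-- `D` raises the number of internal vertices by one, so the scalar is indexed by the target; for
`N = 0` both sides vanish. -/
theorem D_smul_apply (c : ℕ → K) (X : Series K n 1) (N k : ℕ) :
    D K n (fun N k => c (N + 1) • X N k) N k = c N • D K n X N k := by
  rcases N with _ | N
  · change (0 : Comp K n 1 0 k) + 0 = c 0 • (0 + 0)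
    rw [add_zero, smul_zero]
  · rcases k with _ | k
    · change (0 : Comp K n 1 (N + 1) 0) + 0 = c (N + 1) • (0 + 0)
      rw [add_zero, smul_zero]
    · change lift (deltaHairyGraph K n) compatible_deltaHairy (c (N + 1) • X N k)
          + lift (joinHairsGraph K n) compatible_joinHairs (c (N + 1) • X N k)
        = c (N + 1) • (lift (deltaHairyGraph K n) compatible_deltaHairy (X N k)
          + lift (joinHairsGraph K n) compatible_joinHairs (X N k))
      rw [map_smul, map_smul, smul_add]

theorem exists_D_eq_F [CharZero K] {γ : Series K n 0} (hγ : γ ∈ GC1vi K n)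
    (h0 : delta K n γ = 0) : ∃ X ∈ HGC K n, D K n X = F K n γ ∧
      ∀ N k : ℕ, X N k = -hairSign K n (N + 1) • one K n γ N k := by
  -- The component of `γ₁` with `N` internal vertices comes from the part of `γ` with `N + 1`
  -- vertices, which determines the sign.
  refine ⟨fun N k => -hairSign K n (N + 1) • one K n γ N k, ?_, ?_, fun _ _ => rfl⟩
  · have h := one_mem hγ
    rw [HGC, mem_seriesOf] at h
    exact mem_seriesOf.2 fun N k => Submodule.smul_mem _ _ (h N k)
  · funext N k
    rw [F_apply_of_delta_eq_zero hγ h0, D_smul_apply (fun N => -hairSign K n N)]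

end Series

end HairyGraph

end

theorem proposition3p2 (K : Type*) [Field K] [CharZero K] (n : ℤ) :
    -- `GC_n^{1vi}` is closed under `δ`, and the other maps take values in the hairy graph complex
    (∀ γ ∈ HairyGraph.GC1vi K n, HairyGraph.delta K n γ ∈ HairyGraph.GC1vi K n) ∧
    (∀ γ ∈ HairyGraph.GC1vi K n, HairyGraph.one K n γ ∈ HairyGraph.HGC K n) ∧
    (∀ γ ∈ HairyGraph.GC K n, HairyGraph.F K n γ ∈ HairyGraph.HGC K n) ∧
    (∀ Γ ∈ HairyGraph.HGC K n, HairyGraph.D K n Γ ∈ HairyGraph.HGC K n) ∧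
    -- the compatibility relation, on the component with `N` vertices of `γ`
    (∀ γ ∈ HairyGraph.GC1vi K n, ∀ N k : ℕ,
      HairyGraph.one K n (HairyGraph.delta K n γ) N k =
        HairyGraph.D K n (HairyGraph.one K n γ) N k +
          HairyGraph.hairSign K n N • HairyGraph.F K n γ N k) ∧
    -- the consequences for cocycles
    (∀ γ ∈ HairyGraph.GC1vi K n, HairyGraph.delta K n γ = 0 →
      HairyGraph.deltaHairy K n (HairyGraph.F K n γ) = 0 ∧
      (∀ N k : ℕ, HairyGraph.F K n γ N k =
        -HairyGraph.hairSign K n N • HairyGraph.D K n (HairyGraph.one K n γ) N k) ∧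
      ∃ X ∈ HairyGraph.HGC K n, HairyGraph.D K n X = HairyGraph.F K n γ ∧
        ∀ N k : ℕ, X N k = -HairyGraph.hairSign K n (N + 1) • HairyGraph.one K n γ N k) := by
  exact ⟨fun _ => HairyGraph.delta_mem, fun _ => HairyGraph.one_mem, fun _ => HairyGraph.F_mem,
    fun _ => HairyGraph.D_mem, fun _ => HairyGraph.one_delta_apply, fun _ hγ h0 =>
      ⟨HairyGraph.deltaHairy_F_eq_zero (HairyGraph.GC1vi_le_GC hγ) h0,
        HairyGraph.F_apply_of_delta_eq_zero hγ h0, HairyGraph.exists_D_eq_F hγ h0⟩⟩
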